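/- Setting. Let $(X_1,Y_1),\dots,(X_n,Y_n)$ be i.i.d. with law $P$ on $\mathcal X\times\{-1,+1\}$, where $\mathcal X$ is an arbitrary measurable space; let $P_X$ be the marginal of $P$ on $\mathcal X$, $\eta(x)=\mathbf E(Y_1\mid X_1=x)\in[-1,1]$, and let $f(x)=1$ if $\eta(x)>0$, $f(x)=-1$ otherwise, be the Bayes classifier. Let $\Phi_H(u)=\max(1+u,0)$ be the hinge loss, $R_{\Phi_H}[g]=\int\Phi_H(-y\,g(x))\,P(dx,dy)$ the hinge risk and $\ell_{\Phi_H}(g,f)=R_{\Phi_H}[g]-R_{\Phi_H}[f]$ the excess hinge risk. Let $M\ge 2$, let $\phi_1,\dots,\phi_M:\mathcal X\to\mathbb R$ be measurable with $\max_j\|\phi_j\|_{L^\infty(P_X)}\le L_\phi$ for some $L_\phi>0$, and put $f_\lambda=\sum_{j=1}^M\lambda_j\phi_j$ for $\lambda\in\mathbb R^M$. For $R,\tau>0$ with $2M\tau\le R$, the sparsity prior is the probability measure $$\pi(d\lambda)=\frac1{C_{\tau,R}}\prod_{j=1}^M(\tau^2+\lambda_j^2)^{-2}\,\mathbf 1(\|\lambda\|_1\le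 R)\,d\lambda$$ on $\mathbb R^M$. For $\beta>0$, the mirror averaging (MA) aggregate is $$\hat f_n(x)=\frac1{n+1}\sum_{m=0}^n\int f_\lambda(x)\,\hat\theta_{m,\lambda}\,\pi(d\lambda),\qquad \hat\theta_{m,\lambda}=\frac{\exp\{-\frac1\beta\sum_{i=1}^m\Phi_H(-Y_if_\lambda(X_i))\}}{\int\exp\{-\frac1\beta\sum_{i=1}^m\Phi_H(-Y_if_w(X_i))\}\,\pi(dw)}.$$ Statement. (i) For every $\beta>0$, $$\mathbf E[\ell_{\Phi_H}(\hat f_n,f)]\le\min_{\|\lambda^*\|_1\le R-2M\tau}\Big(\ell_{\Phi_H}(f_{\lambda^*},f)+\frac{4\beta}{n+1}\sum_{j=1}^M\log(1+\tau^{-1}|\lambda_j^*|)\Big)+\frac{2(1+RL_\phi)^2}{\beta}e^{(1+RL_\phi)/\beta}+4\tau L_\phi\sqrt M+\frac{\beta}{n+1},$$ where the minimum is attained and the expectation is that of an integrable random variable. (ii) There is a constant $C>0$ depending only on $R$ and $L_\phi$ such that, for all integers $1\le M^*\le n$, the choice $\beta=(1+RL_\phi)\sqrt{n/M^*}$ and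 $\tau=\min\big(\frac1{\sqrt{nM}},\frac R{4M}\big)$ gives $$\mathbf E[\ell_{\Phi_H}(\hat f_n,f)]\le\min_{\|\lambda^*\|_1\le R/2,\ \|\lambda^*\|_0\le M^*}\Big(\ell_{\Phi_H}(f_{\lambda^*},f)+\frac{(1+RL_\phi)\sqrt{M^*}}{\sqrt n}\big\{C+4\log(1+\tau^{-1}\|\lambda^*\|_1)\big\}\Big),$$ where $\|\lambda^*\|_0$ is the number of non-zero coordinates of $\lambda^*$. -/

import Mathlib

open MeasureTheory

noncomputable section

namespace MirrorAveraging

/-- The two class labels `-1` and `+1`. -/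
abbrev Label : Type := ({-1, 1} : Set ℝ)

/-- The hinge function `Φ_H(u) = max(1 + u, 0)`. -/
def hinge (u : ℝ) : ℝ := max (1 + u) 0

/-- The `ℓ¹` norm of a vector. -/
def l1Norm {M : ℕ} (w : Fin M → ℝ) : ℝ := ∑ j, |w j|

/-- The number of non-zero coordinates of a vector. -/
def l0Norm {M : ℕ} (w : Fin M → ℝ) : ℕ := (Finset.univ.filter fun j => w j ≠ 0).card

section Classification

variable {X : Type*} [MeasurableSpace X]

/-- The loss `Q(z, g) = Φ(-y g(x))` of the classifier `g` at the observation `z = (x, y)`. -/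
def pointLoss (Φ : ℝ → ℝ) (z : X × Label) (g : X → ℝ) : ℝ := Φ (-(z.2 : ℝ) * g z.1)

/-- The `Φ`-risk `R_Φ[g] = ∫ Φ(-y g(x)) P(dx, dy)`. -/
def phiRisk (Φ : ℝ → ℝ) (P : Measure (X × Label)) (g : X → ℝ) : ℝ :=
  ∫ z, pointLoss Φ z g ∂P

/-- `η : X → [-1, 1]` is (a version of) the regression function `x ↦ E(Y | X = x)`. -/
structure IsRegressionFunction (P : Measure (X × Label)) (η : X → ℝ) : Prop where
  measurable : Measurable η
  mem_Icc : ∀ x, η x ∈ Set.Icc (-1 : ℝ) 1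
  ae_eq_condExp : (fun z : X × Label => η z.1) =ᵐ[P]
    P[fun z : X × Label => (z.2 : ℝ) | MeasurableSpace.comap Prod.fst inferInstance]

/-- The Bayes classifier `1(η(x) > 0) - 1(η(x) ≤ 0)`; it also minimises the hinge risk. -/
def bayesClassifier (η : X → ℝ) (x : X) : ℝ :=
  open Classical in if 0 < η x then 1 else -1

/-- The excess hinge risk of `g`, relative to the Bayes classifier attached to `η`. -/
def excessHingeRisk (P : Measure (X × Label)) (η : X → ℝ) (g : X → ℝ) : ℝ :=
  phiRisk hinge P g - phiRisk hinge P (bayesClassifier η)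

/-- The linear combination `f_w = ∑ j, w_j φ_j`. -/
def linComb {M : ℕ} (φ : Fin M → X → ℝ) (w : Fin M → ℝ) (x : X) : ℝ := ∑ j, w j * φ j x

end Classification

/-- The unnormalised sparsity prior density `∏ j, (τ² + w_j²)⁻²`. -/
def priorWeight {M : ℕ} (τ : ℝ) (w : Fin M → ℝ) : ℝ := ∏ j, ((τ ^ 2 + w j ^ 2) ^ 2)⁻¹

/-- The normalising constant `C_{τ,R}` of the sparsity prior. -/
def priorConst (M : ℕ) (τ R : ℝ) : ℝ :=
  ∫ w in {w : Fin M → ℝ | l1Norm w ≤ R}, priorWeight τ w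

/-- The sparsity prior
`π(dw) = C_{τ,R}⁻¹ ∏ j, (τ² + w_j²)⁻² 1(‖w‖₁ ≤ R) dw` on `ℝ^M`. -/
def sparsityPrior (M : ℕ) (τ R : ℝ) : Measure (Fin M → ℝ) :=
  (volume.restrict {w : Fin M → ℝ | l1Norm w ≤ R}).withDensity
    fun w => ENNReal.ofReal ((priorConst M τ R)⁻¹ * priorWeight τ w)

section Aggregate

variable {X : Type*} {M n : ℕ}

/-- The unnormalised exponential weight `exp(-β⁻¹ ∑_{i ≤ m} Q(Z_i, f_w))` of the parameter `w`,
computed from the first `m` observations of the sample `Z`. -/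
def expWeight (Q : X × Label → (X → ℝ) → ℝ) (φ : Fin M → X → ℝ) (β : ℝ)
    (Z : Fin n → X × Label) (m : ℕ) (w : Fin M → ℝ) : ℝ :=
  Real.exp (-(1 / β) * ∑ i : Fin n with i.val < m, Q (Z i) (linComb φ w))

/-- The density `θ̂_{m,w}(Z)` with respect to the prior `π`. For a probability measure `π`
it is identically `1` when `m = 0`. -/
def posteriorDensity (Q : X × Label → (X → ℝ) → ℝ) (φ : Fin M → X → ℝ)
    (π : Measure (Fin M → ℝ)) (β : ℝ) (Z : Fin n → X × Label) (m : ℕ) (w : Fin M → ℝ) : ℝ :=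
  expWeight Q φ β Z m w / ∫ v, expWeight Q φ β Z m v ∂π

/-- The mirror averaging density `θ̂_w(Z) = (n+1)⁻¹ ∑_{m=0}^n θ̂_{m,w}(Z)`. -/
def maDensity (Q : X × Label → (X → ℝ) → ℝ) (φ : Fin M → X → ℝ)
    (π : Measure (Fin M → ℝ)) (β : ℝ) (Z : Fin n → X × Label) (w : Fin M → ℝ) : ℝ :=
  1 / ((n : ℝ) + 1) * ∑ m ∈ Finset.range (n + 1), posteriorDensity Q φ π β Z m w

/-- The mirror averaging aggregate `f̂_n(Z, x) = ∫ f_w(x) θ̂_w(Z) π(dw)`. -/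
def maAggregate (Q : X × Label → (X → ℝ) → ℝ) (φ : Fin M → X → ℝ)
    (π : Measure (Fin M → ℝ)) (β : ℝ) (Z : Fin n → X × Label) (x : X) : ℝ :=
  ∫ w, linComb φ w x * maDensity Q φ π β Z w ∂π

/-- The mirror averaging aggregate for the hinge loss with the sparsity prior. -/
def hingeMA (φ : Fin M → X → ℝ) (τ R β : ℝ) (Z : Fin n → X × Label) : X → ℝ :=
  maAggregate (pointLoss hinge) φ (sparsityPrior M τ R) β Z

end Aggregate

/-- The expectation of the excess hinge risk of the mirror averaging aggregate built from a
sample of size `n` with law `P^n`. -/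
def expectedExcessRisk {X : Type*} [MeasurableSpace X] {M : ℕ} (n : ℕ)
    (P : Measure (X × Label)) (η : X → ℝ) (φ : Fin M → X → ℝ) (τ R β : ℝ) : ℝ :=
  ∫ Z : Fin n → X × Label, excessHingeRisk P η (hingeMA φ τ R β Z) ∂(Measure.pi fun _ => P)

end MirrorAveraging

end

open MirrorAveraging

namespace MirrorAveraging

open Filter Topology

/-! ### One-dimensional integrals of the prior density -/

/-! The proof combines online-to-batch conversion, a pathwise regret bound and a comparison measure
tailored to the prior.

The hinge loss is convex, so by Jensen the loss of the aggregate at a fresh observation is at most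
the average over `m ≤ n` of the posterior mean losses (`pointLoss_maAggregate_le`). The posterior of
index `m` sees only the first `m` observations. By the i.i.d. assumption the fresh point may
therefore be placed at position `m` of a sample of size `n + 1` (`integral_posteriorLoss_eq`), and
the sum over `m` becomes the expected cumulative loss of exponential weighting on that sample.

For each such sample with bounded dictionary values, `exp_weights_regret` bounds this loss: the
log-partition functions telescope, and Jensen for `exp` compares the last one with any `ρ` of
density at most `exp K` with respect to the prior. The price is `β K` plus a second order term for
each round.

Given a centre `a`, `ρ` is the prior on the ball of radius `2Mτ` translated to `a`. Heavy tails make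
the translation cost only `4 ∑ log (1 + |a_j| / τ)`, and the truncation costs at most a factor `e`
(`map_add_sparsityPrior_le`). Coordinates under the small prior are uncorrelated with second moment
at most `2τ²`, so averaging over `ρ` costs at most `4τL√M` (`integral_abs_sum_sparsityPrior_le`).
The tuned rate follows by substitution, since zero coordinates of `a` contribute nothing to the
logarithmic sum. The minima are attained because a continuous function is minimised over a nonempty
compact set. -/

lemma integrable_inv_sq_add_sq {τ : ℝ} (hτ : 0 < τ) :
    Integrable fun u : ℝ => (τ ^ 2 + u ^ 2)⁻¹ := by
  have h := (integrable_inv_one_add_sq.comp_div hτ.ne').const_mul (τ ^ 2)⁻¹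
  refine h.congr (ae_of_all _ fun u => ?_)
  have : 0 < τ ^ 2 + u ^ 2 := by positivity
  have : 1 + (u / τ) ^ 2 ≠ 0 := by positivity
  field_simp

lemma integrable_inv_sq_add_sq_sq {τ : ℝ} (hτ : 0 < τ) :
    Integrable fun u : ℝ => ((τ ^ 2 + u ^ 2) ^ 2)⁻¹ := by
  refine ((integrable_inv_sq_add_sq hτ).const_mul (τ ^ 2)⁻¹).mono' (by fun_prop)
    (ae_of_all _ fun u => ?_)
  have h : 0 < τ ^ 2 + u ^ 2 := by positivity
  rw [Real.norm_of_nonneg (by positivity), pow_two (τ ^ 2 + u ^ 2), mul_inv]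
  gcongr
  nlinarith [sq_nonneg u]

lemma integrable_sq_mul_inv_sq_add_sq_sq {τ : ℝ} (hτ : 0 < τ) :
    Integrable fun u : ℝ => u ^ 2 * ((τ ^ 2 + u ^ 2) ^ 2)⁻¹ := by
  refine (integrable_inv_sq_add_sq hτ).mono' (by fun_prop) (ae_of_all _ fun u => ?_)
  have h : 0 < τ ^ 2 + u ^ 2 := by positivity
  rw [Real.norm_of_nonneg (by positivity), ← div_eq_mul_inv, inv_eq_one_div,
    div_le_div_iff₀ (by positivity) h]
  nlinarith [mul_pos h (pow_pos hτ 2)]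

/-- The difference of the two integrands is the derivative of `u / (τ² + u²)`, which vanishes at
both infinities. So the normalised density has second moment exactly `τ²`, without evaluating either
integral. -/
lemma integral_sq_mul_inv_sq_add_sq_sq {τ : ℝ} (hτ : 0 < τ) :
    ∫ u : ℝ, u ^ 2 * ((τ ^ 2 + u ^ 2) ^ 2)⁻¹ = τ ^ 2 * ∫ u : ℝ, ((τ ^ 2 + u ^ 2) ^ 2)⁻¹ := by
  have hpos : ∀ u : ℝ, 0 < τ ^ 2 + u ^ 2 := fun u => by positivity
  have hd : ∀ u : ℝ, HasDerivAt (fun u : ℝ => u / (τ ^ 2 + u ^ 2))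
      (τ ^ 2 * ((τ ^ 2 + u ^ 2) ^ 2)⁻¹ - u ^ 2 * ((τ ^ 2 + u ^ 2) ^ 2)⁻¹) u := fun u => by
    have h1 : HasDerivAt (fun u : ℝ => τ ^ 2 + u ^ 2) (2 * u) u := by
      simpa using (hasDerivAt_pow 2 u).const_add (τ ^ 2)
    refine ((hasDerivAt_id u).div h1 (hpos u).ne').congr_deriv ?_
    have := (hpos u).ne'
    simp only [id]
    field_simp
    ring
  have hb : ∀ u : ℝ, ‖u / (τ ^ 2 + u ^ 2)‖ ≤ ‖u⁻¹‖ := fun u => by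
    rcases eq_or_ne u 0 with rfl | hu
    · simp
    · rw [norm_div, Real.norm_of_nonneg (hpos u).le, norm_inv, Real.norm_eq_abs, inv_eq_one_div,
        div_le_div_iff₀ (hpos u) (abs_pos.2 hu), abs_mul_abs_self]
      nlinarith [sq_nonneg τ]
  have hi := ((integrable_inv_sq_add_sq_sq hτ).const_mul (τ ^ 2)).sub
    (integrable_sq_mul_inv_sq_add_sq_sq hτ)
  have h := integral_of_hasDerivAt_of_tendsto hd hi
    (squeeze_zero_norm hb (by simpa using (tendsto_inv_atBot_zero (𝕜 := ℝ)).norm))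
    (squeeze_zero_norm hb (by simpa using (tendsto_inv_atTop_zero (𝕜 := ℝ)).norm))
  rw [integral_sub ((integrable_inv_sq_add_sq_sq hτ).const_mul (τ ^ 2))
    (integrable_sq_mul_inv_sq_add_sq_sq hτ), integral_const_mul] at h
  linarith

/-! ### The sparsity prior -/

section Prior

variable {M : ℕ} {τ R : ℝ}

lemma continuous_l1Norm : Continuous (l1Norm : (Fin M → ℝ) → ℝ) := by
  unfold l1Norm; fun_prop

lemma l1Norm_nonneg (w : Fin M → ℝ) : 0 ≤ l1Norm w :=
  Finset.sum_nonneg fun _ _ => abs_nonneg _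

lemma l1Norm_add_le (v w : Fin M → ℝ) : l1Norm (v + w) ≤ l1Norm v + l1Norm w := by
  simp only [l1Norm, ← Finset.sum_add_distrib]
  exact Finset.sum_le_sum fun j _ => abs_add_le _ _

lemma abs_le_l1Norm (w : Fin M → ℝ) (j : Fin M) : |w j| ≤ l1Norm w :=
  Finset.single_le_sum (f := fun j => |w j|) (fun _ _ => abs_nonneg _) (Finset.mem_univ j)

lemma measurableSet_l1Norm_le (r : ℝ) : MeasurableSet {w : Fin M → ℝ | l1Norm w ≤ r} :=
  (isClosed_le continuous_l1Norm continuous_const).measurableSet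

lemma isCompact_l1Norm_le (r : ℝ) : IsCompact {w : Fin M → ℝ | l1Norm w ≤ r} := by
  refine Metric.isCompact_of_isClosed_isBounded
    (isClosed_le continuous_l1Norm continuous_const) ?_
  refine (Metric.isBounded_closedBall (x := (0 : Fin M → ℝ)) (r := r)).subset fun w hw => ?_
  rw [mem_closedBall_zero_iff, pi_norm_le_iff_of_nonneg ((l1Norm_nonneg w).trans hw)]
  exact fun j => (abs_le_l1Norm w j).trans hw

lemma priorWeight_pos (hτ : 0 < τ) (w : Fin M → ℝ) : 0 < priorWeight τ w :=
  Finset.prod_pos fun j _ => by positivity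

lemma continuous_priorWeight (hτ : 0 < τ) : Continuous (priorWeight τ : (Fin M → ℝ) → ℝ) := by
  unfold priorWeight
  refine continuous_finsetProd _ fun j _ => Continuous.inv₀ (by fun_prop) fun w => ?_
  positivity

lemma integrable_priorWeight (hτ : 0 < τ) :
    Integrable (priorWeight τ : (Fin M → ℝ) → ℝ) :=
  Integrable.fintype_prod (f := fun _ u => ((τ ^ 2 + u ^ 2) ^ 2)⁻¹)
    fun _ => integrable_inv_sq_add_sq_sq hτ

/-- Product form, so that integrability and the integral reduce to one-dimensional factors. -/
lemma sq_mul_priorWeight (j : Fin M) (w : Fin M → ℝ) : w j ^ 2 * priorWeight τ w =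
    ∏ i, (if i = j then w i ^ 2 * ((τ ^ 2 + w i ^ 2) ^ 2)⁻¹ else ((τ ^ 2 + w i ^ 2) ^ 2)⁻¹) := by
  rw [priorWeight, ← Finset.mul_prod_erase _ _ (Finset.mem_univ j),
    ← Finset.mul_prod_erase (a := j) (s := Finset.univ) (h := Finset.mem_univ j), if_pos rfl,
    mul_assoc]
  congr 2
  exact Finset.prod_congr rfl fun i hi => (if_neg (Finset.ne_of_mem_erase hi)).symm

lemma integrable_sq_mul_priorWeight (hτ : 0 < τ) (j : Fin M) :
    Integrable fun w : Fin M → ℝ => w j ^ 2 * priorWeight τ w := by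
  simp only [sq_mul_priorWeight]
  refine Integrable.fintype_prod (f := fun i u =>
    if i = j then u ^ 2 * ((τ ^ 2 + u ^ 2) ^ 2)⁻¹ else ((τ ^ 2 + u ^ 2) ^ 2)⁻¹) fun i => ?_
  dsimp only
  split_ifs
  · exact integrable_sq_mul_inv_sq_add_sq_sq hτ
  · exact integrable_inv_sq_add_sq_sq hτ

lemma integral_sq_mul_priorWeight (hτ : 0 < τ) (j : Fin M) :
    ∫ w : Fin M → ℝ, w j ^ 2 * priorWeight τ w = τ ^ 2 * ∫ w : Fin M → ℝ, priorWeight τ w := by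
  simp only [sq_mul_priorWeight]
  rw [integral_fintype_prod_volume_eq_prod (fun i (u : ℝ) =>
    if i = j then u ^ 2 * ((τ ^ 2 + u ^ 2) ^ 2)⁻¹ else ((τ ^ 2 + u ^ 2) ^ 2)⁻¹)]
  simp only [priorWeight]
  rw [integral_fintype_prod_volume_eq_prod (fun (_ : Fin M) (u : ℝ) => ((τ ^ 2 + u ^ 2) ^ 2)⁻¹),
    ← Finset.mul_prod_erase _ _ (Finset.mem_univ j),
    ← Finset.mul_prod_erase (a := j) (s := Finset.univ) (h := Finset.mem_univ j), ← mul_assoc]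
  simp only [if_true, integral_sq_mul_inv_sq_add_sq_sq hτ]
  congr 1
  refine Finset.prod_congr rfl fun i hi => ?_
  simp [Finset.ne_of_mem_erase hi]

lemma priorConst_pos (hτ : 0 < τ) (hR : 0 < R) : 0 < priorConst M τ R := by
  rw [priorConst, setIntegral_pos_iff_support_of_nonneg_ae
    (ae_of_all _ fun w => (priorWeight_pos hτ w).le) (integrable_priorWeight hτ).integrableOn]
  have hs : Function.support (priorWeight τ : (Fin M → ℝ) → ℝ) = Set.univ :=
    Set.eq_univ_of_forall fun w => (priorWeight_pos hτ w).ne'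
  rw [hs, Set.univ_inter]
  refine lt_of_lt_of_le ?_ (measure_mono (s := {w : Fin M → ℝ | l1Norm w < R})
    fun w hw => le_of_lt (Set.mem_ofPred.1 hw))
  exact (isOpen_lt continuous_l1Norm continuous_const).measure_pos _ ⟨0, by simpa [l1Norm] using hR⟩

/-- Markov's inequality: the ball of radius `2Mτ` carries at least half of the mass of the
untruncated density. -/
lemma integral_priorWeight_le (hM : 0 < M) (hτ : 0 < τ) :
    ∫ w : Fin M → ℝ, priorWeight τ w ≤ 2 * priorConst M τ (2 * M * τ) := by
  set I := ∫ w : Fin M → ℝ, priorWeight τ w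
  have hM' : (0 : ℝ) < M := by exact_mod_cast hM
  set A := {w : Fin M → ℝ | l1Norm w ≤ 2 * M * τ}
  have hA : MeasurableSet A := measurableSet_l1Norm_le _
  have hsplit : (∫ w in A, priorWeight τ w) + ∫ w in Aᶜ, priorWeight τ w = I :=
    integral_add_compl hA (integrable_priorWeight hτ)
  -- `g` dominates `‖w‖₁ / (2Mτ)` times the density through `|w_j| ≤ (τ + w_j²/τ) / 2`. Since the
  -- second moments are `τ²`, the mean `ℓ¹` norm is at most `Mτ`, which is where the fraction one
  -- half comes from.
  set g : (Fin M → ℝ) → ℝ := fun w =>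
    ∑ j, (4 * M * τ)⁻¹ * (τ * priorWeight τ w + τ⁻¹ * (w j ^ 2 * priorWeight τ w))
  have hgi : ∀ j : Fin M, Integrable fun w : Fin M → ℝ =>
      (4 * M * τ)⁻¹ * (τ * priorWeight τ w + τ⁻¹ * (w j ^ 2 * priorWeight τ w)) := fun j =>
    (((integrable_priorWeight hτ).const_mul τ).add
      ((integrable_sq_mul_priorWeight hτ j).const_mul τ⁻¹)).const_mul _
  have hg : Integrable g := integrable_finsetSum _ fun j _ => hgi j
  have hgI : ∫ w, g w = I / 2 := by
    rw [integral_finsetSum _ fun j _ => hgi j]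
    have : ∀ j : Fin M, ∫ w : Fin M → ℝ,
        (4 * M * τ)⁻¹ * (τ * priorWeight τ w + τ⁻¹ * (w j ^ 2 * priorWeight τ w)) =
        (2 * (M : ℝ))⁻¹ * I := fun j => by
      rw [integral_const_mul, integral_add ((integrable_priorWeight hτ).const_mul τ)
        ((integrable_sq_mul_priorWeight hτ j).const_mul τ⁻¹), integral_const_mul,
        integral_const_mul, integral_sq_mul_priorWeight hτ]
      change (4 * M * τ)⁻¹ * (τ * I + τ⁻¹ * (τ ^ 2 * I)) = _
      field_simp
      ring
    simp only [this, Finset.sum_const, Finset.card_univ, Fintype.card_fin, nsmul_eq_mul]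
    field_simp
  have hg0 : ∀ w, 0 ≤ g w := fun w => Finset.sum_nonneg fun j _ => by
    have := priorWeight_pos hτ w
    positivity
  have hle : ∫ w in Aᶜ, priorWeight τ w ≤ I / 2 := by
    rw [← hgI]
    refine le_trans (setIntegral_mono_on (integrable_priorWeight hτ).integrableOn hg.integrableOn
      hA.compl fun w hw => ?_) (setIntegral_le_integral hg (ae_of_all _ hg0))
    have hw' : 2 * M * τ ≤ l1Norm w := (not_le.1 (Set.notMem_ofPred_iff.1 hw)).le
    have hp := priorWeight_pos hτ w
    have h1 : ∀ j : Fin M, (2 * M * τ)⁻¹ * priorWeight τ w * |w j| ≤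
        (4 * M * τ)⁻¹ * (τ * priorWeight τ w + τ⁻¹ * (w j ^ 2 * priorWeight τ w)) := fun j => by
      have h2 : |w j| ≤ (τ + τ⁻¹ * w j ^ 2) / 2 := by
        rw [← sq_abs (w j)]
        have : τ⁻¹ * (τ - |w j|) ^ 2 = τ + τ⁻¹ * |w j| ^ 2 - 2 * |w j| := by field_simp; ring
        have h3 : 0 ≤ τ⁻¹ * (τ - |w j|) ^ 2 := by positivity
        linarith
      calc (2 * M * τ)⁻¹ * priorWeight τ w * |w j|
          ≤ (2 * M * τ)⁻¹ * priorWeight τ w * ((τ + τ⁻¹ * w j ^ 2) / 2) := by gcongr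
        _ = _ := by field_simp; ring
    calc priorWeight τ w = (2 * M * τ)⁻¹ * priorWeight τ w * (2 * M * τ) := by field_simp
      _ ≤ (2 * M * τ)⁻¹ * priorWeight τ w * l1Norm w := by gcongr
      _ = ∑ j, (2 * M * τ)⁻¹ * priorWeight τ w * |w j| := by rw [l1Norm, Finset.mul_sum]
      _ ≤ g w := Finset.sum_le_sum fun j _ => h1 j
  have : priorConst M τ (2 * M * τ) = ∫ w in A, priorWeight τ w := rfl
  linarith

lemma priorConst_le_integral (hτ : 0 < τ) :
    priorConst M τ R ≤ ∫ w : Fin M → ℝ, priorWeight τ w :=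
  setIntegral_le_integral (integrable_priorWeight hτ)
    (ae_of_all _ fun w => (priorWeight_pos hτ w).le)

lemma measurable_ofReal_priorWeight (hτ : 0 < τ) (c : ℝ) :
    Measurable fun w : Fin M → ℝ => ENNReal.ofReal (c * priorWeight τ w) :=
  ((continuous_priorWeight hτ).measurable.const_mul c).ennreal_ofReal

lemma isProbabilityMeasure_sparsityPrior (hτ : 0 < τ) (hR : 0 < R) :
    IsProbabilityMeasure (sparsityPrior M τ R) := by
  have hC := priorConst_pos (M := M) hτ hR
  constructor
  rw [sparsityPrior, withDensity_apply _ MeasurableSet.univ, Measure.restrict_univ,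
    ← ofReal_integral_eq_lintegral_ofReal ((integrable_priorWeight hτ).integrableOn.const_mul _)
      (ae_of_all _ fun w => by have := priorWeight_pos hτ w; positivity), integral_const_mul]
  change ENNReal.ofReal ((priorConst M τ R)⁻¹ * priorConst M τ R) = 1
  rw [inv_mul_cancel₀ hC.ne', ENNReal.ofReal_one]

lemma ae_l1Norm_le_sparsityPrior : ∀ᵐ w ∂sparsityPrior M τ R, l1Norm w ≤ R :=
  (withDensity_absolutelyContinuous _ _).ae_le (ae_restrict_mem (measurableSet_l1Norm_le R))

lemma integral_sparsityPrior (hτ : 0 < τ) (hR : 0 < R) (f : (Fin M → ℝ) → ℝ) :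
    ∫ w, f w ∂sparsityPrior M τ R =
      (priorConst M τ R)⁻¹ * ∫ w in {w | l1Norm w ≤ R}, f w * priorWeight τ w := by
  have hC := priorConst_pos (M := M) hτ hR
  rw [sparsityPrior, integral_withDensity_eq_integral_toReal_smul
    (measurable_ofReal_priorWeight hτ _) (ae_of_all _ fun _ => ENNReal.ofReal_lt_top),
    ← integral_const_mul]
  refine integral_congr_ae (ae_of_all _ fun w => ?_)
  have := priorWeight_pos hτ w
  dsimp only
  rw [ENNReal.toReal_ofReal (by positivity), smul_eq_mul]
  ring

/-- A continuous function is integrable with respect to the (compactly supported) prior. -/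
lemma integrable_sparsityPrior (hτ : 0 < τ) (hR : 0 < R) {f : (Fin M → ℝ) → ℝ}
    (hf : Continuous f) : Integrable f (sparsityPrior M τ R) := by
  have := isProbabilityMeasure_sparsityPrior (M := M) hτ hR
  obtain ⟨b, hb⟩ := (isCompact_l1Norm_le (M := M) R).exists_bound_of_continuousOn hf.continuousOn
  exact Integrable.of_bound hf.aestronglyMeasurable b
    (ae_l1Norm_le_sparsityPrior.mono fun w hw => hb w hw)

/-- Dropping the truncation in the numerator gives `τ²` times the full mass, and the full mass is at
most twice the normalising constant. -/
lemma integral_sq_sparsityPrior_le (hM : 0 < M) (hτ : 0 < τ) (j : Fin M) :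
    ∫ w, w j ^ 2 ∂sparsityPrior M τ (2 * M * τ) ≤ 2 * τ ^ 2 := by
  have hM' : (0 : ℝ) < M := by exact_mod_cast hM
  have hr : 0 < 2 * M * τ := by positivity
  have hC := priorConst_pos (M := M) hτ hr
  rw [integral_sparsityPrior hτ hr, inv_mul_le_iff₀ hC]
  calc ∫ w in {w : Fin M → ℝ | l1Norm w ≤ 2 * M * τ}, w j ^ 2 * priorWeight τ w
      ≤ ∫ w : Fin M → ℝ, w j ^ 2 * priorWeight τ w :=
        setIntegral_le_integral (integrable_sq_mul_priorWeight hτ j)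
          (ae_of_all _ fun w => by have := priorWeight_pos hτ w; positivity)
    _ = τ ^ 2 * ∫ w : Fin M → ℝ, priorWeight τ w := integral_sq_mul_priorWeight hτ j
    _ ≤ τ ^ 2 * (2 * priorConst M τ (2 * M * τ)) := by
        gcongr; exact integral_priorWeight_le hM hτ
    _ = _ := by ring

/-- Changing the sign of the `i`-th coordinate. -/
def flipSign (i : Fin M) (w : Fin M → ℝ) : Fin M → ℝ := fun k => if k = i then -w k else w k

lemma measurePreserving_flipSign (i : Fin M) : MeasurePreserving (flipSign i) := by
  refine volume_preserving_pi (f := fun k (u : ℝ) => if k = i then -u else u) fun k => ?_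
  split_ifs
  · exact Measure.measurePreserving_neg volume
  · exact MeasurePreserving.id _

lemma flipSign_flipSign (i : Fin M) (w : Fin M → ℝ) : flipSign i (flipSign i w) = w := by
  ext k; by_cases h : k = i <;> simp [flipSign, h]

/-- Flipping the sign of coordinate `i` preserves Lebesgue measure, the ball and the density but
negates the integrand. The truncated coordinates are not independent, but uncorrelatedness is all
that is needed. -/
lemma integral_mul_sparsityPrior (hτ : 0 < τ) (hR : 0 < R) {i j : Fin M} (hij : i ≠ j) :
    ∫ w, w i * w j ∂sparsityPrior M τ R = 0 := by
  rw [integral_sparsityPrior hτ hR]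
  have hl : ∀ w : Fin M → ℝ, l1Norm (flipSign i w) = l1Norm w := fun w =>
    Finset.sum_congr rfl fun k _ => by by_cases h : k = i <;> simp [flipSign, h]
  have hp : ∀ w : Fin M → ℝ, priorWeight τ (flipSign i w) = priorWeight τ w := fun w =>
    Finset.prod_congr rfl fun k _ => by by_cases h : k = i <;> simp [flipSign, h]
  let e : (Fin M → ℝ) ≃ᵐ (Fin M → ℝ) :=
    ⟨⟨flipSign i, flipSign i, flipSign_flipSign i, flipSign_flipSign i⟩,
      (measurePreserving_flipSign i).measurable, (measurePreserving_flipSign i).measurable⟩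
  have h := (measurePreserving_flipSign i).setIntegral_preimage_emb e.measurableEmbedding
    (fun w => w i * w j * priorWeight τ w) {w | l1Norm w ≤ R}
  have hs : flipSign i ⁻¹' {w | l1Norm w ≤ R} = {w | l1Norm w ≤ R} := by
    ext w; simp [hl]
  have hf : ∀ w : Fin M → ℝ, flipSign i w i * flipSign i w j * priorWeight τ (flipSign i w) =
      -(w i * w j * priorWeight τ w) := fun w => by
    rw [hp]; simp [flipSign, hij.symm]
  simp only [hs, hf, integral_neg] at h
  have : ∫ w in {w : Fin M → ℝ | l1Norm w ≤ R}, w i * w j * priorWeight τ w = 0 := by linarith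
  rw [this, mul_zero]

lemma integral_abs_sum_sparsityPrior_le {L : ℝ} (hL : 0 < L) (hM : 0 < M) (hτ : 0 < τ)
    (c : Fin M → ℝ) (hc : ∀ j, |c j| ≤ L) :
    ∫ w, |∑ j, w j * c j| ∂sparsityPrior M τ (2 * M * τ) ≤ 4 * τ * L * √(M : ℝ) := by
  have hM' : (0 : ℝ) < M := by exact_mod_cast hM
  have hr : 0 < 2 * M * τ := by positivity
  have := isProbabilityMeasure_sparsityPrior (M := M) hτ hr
  set π := sparsityPrior M τ (2 * M * τ)
  have hint : ∀ i j : Fin M, Integrable (fun w : Fin M → ℝ => c i * c j * (w i * w j)) π :=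
    fun i j => integrable_sparsityPrior hτ hr (by fun_prop)
  have hsq : ∫ w, (∑ j, w j * c j) ^ 2 ∂π ≤ M * (L ^ 2 * (2 * τ ^ 2)) := by
    have h1 : ∀ w : Fin M → ℝ, (∑ j, w j * c j) ^ 2 = ∑ i, ∑ j, c i * c j * (w i * w j) :=
      fun w => by
        rw [sq, Finset.sum_mul_sum]
        exact Finset.sum_congr rfl fun i _ => Finset.sum_congr rfl fun j _ => by ring
    simp only [h1]
    rw [integral_finsetSum _ fun i _ => integrable_finsetSum _ fun j _ => hint i j]
    calc ∑ i, ∫ w, ∑ j, c i * c j * (w i * w j) ∂π ≤ ∑ _i : Fin M, L ^ 2 * (2 * τ ^ 2) := by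
          refine Finset.sum_le_sum fun i _ => ?_
          rw [integral_finsetSum _ fun j _ => hint i j, Finset.sum_eq_single i]
          · rw [integral_const_mul, ← sq]
            have h2 : c i ^ 2 ≤ L ^ 2 := by rw [← sq_abs]; gcongr; exact hc i
            have h3 := integral_sq_sparsityPrior_le hM hτ i
            simp only [← sq]
            refine mul_le_mul h2 h3 (integral_nonneg fun w => by positivity) (by positivity)
          · intro j _ hj
            rw [integral_const_mul, integral_mul_sparsityPrior hτ hr hj.symm, mul_zero]
          · simp
      _ = _ := by simp
  set s := √(M : ℝ)
  have hs : 0 < s := Real.sqrt_pos.2 hM'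
  have hs2 : s ^ 2 = M := Real.sq_sqrt hM'.le
  -- The second moment of the sum is at most `2b²`. The inequality `|t| ≤ b/2 + t²/(2b)` then
  -- replaces Cauchy–Schwarz and gives `3b/2`, below the required `4b`.
  set b := τ * L * s with hb
  have hb0 : 0 < b := by positivity
  calc ∫ w, |∑ j, w j * c j| ∂π ≤ ∫ w, (b / 2 + (2 * b)⁻¹ * (∑ j, w j * c j) ^ 2) ∂π := by
        refine integral_mono (integrable_sparsityPrior hτ hr (by fun_prop))
          (integrable_sparsityPrior hτ hr (by fun_prop)) fun w => ?_
        dsimp only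
        set t := ∑ j, w j * c j
        rw [← sq_abs t]
        have h3 : 0 ≤ (2 * b)⁻¹ * (b - |t|) ^ 2 := by positivity
        have : (2 * b)⁻¹ * (b - |t|) ^ 2 = b / 2 + (2 * b)⁻¹ * |t| ^ 2 - |t| := by
          field_simp; ring
        linarith
    _ = b / 2 + (2 * b)⁻¹ * ∫ w, (∑ j, w j * c j) ^ 2 ∂π := by
        rw [integral_add (integrable_const _) (integrable_sparsityPrior hτ hr (by fun_prop)),
          integral_const_mul, integral_const, probReal_univ, one_smul]
    _ ≤ b / 2 + (2 * b)⁻¹ * (M * (L ^ 2 * (2 * τ ^ 2))) := by gcongr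
    _ = b / 2 + b := by
        rw [← hs2, hb]; field_simp
    _ ≤ 4 * τ * L * s := by rw [hb] at *; linarith

/-- Coordinatewise, with `t = |a_j| / τ`, one has `τ² + (a_j + w_j)² ≤ (1 + t)² (τ² + w_j²)`.
Squaring gives `(1 + t)⁴`, hence the factor `4` in front of the logarithm. Polynomial tails are what
make this cost logarithmic in `a`. -/
lemma priorWeight_le_of_translate (hτ : 0 < τ) (a w : Fin M → ℝ) :
    priorWeight τ w ≤ Real.exp (4 * ∑ j, Real.log (1 + τ⁻¹ * |a j|)) * priorWeight τ (a + w) := by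
  rw [Finset.mul_sum, Real.exp_sum, priorWeight, priorWeight, ← Finset.prod_mul_distrib]
  refine Finset.prod_le_prod (fun j _ => by positivity) fun j _ => ?_
  set t := τ⁻¹ * |a j| with ht
  have ht0 : 0 ≤ t := by positivity
  have hexp : Real.exp (4 * Real.log (1 + t)) = ((1 + t) ^ 2) ^ 2 := by
    rw [mul_comm, Real.exp_mul, Real.exp_log (by positivity), ← pow_mul]
    norm_cast
  rw [hexp, ← div_eq_mul_inv, inv_eq_one_div, div_le_div_iff₀ (by positivity) (by positivity),
    one_mul, ← mul_pow, Pi.add_apply]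
  refine pow_le_pow_left₀ (by positivity) ?_ 2
  have ha : |a j| = τ * t := by rw [ht]; field_simp
  have h1 : (a j + w j) ^ 2 ≤ (τ * t + |w j|) ^ 2 := by
    rw [← ha, ← sq_abs (a j + w j)]
    gcongr
    exact abs_add_le _ _
  have h2 := sq_abs (w j)
  nlinarith [mul_nonneg ht0 (sq_nonneg (τ - |w j|)), mul_nonneg ht0 (sq_nonneg τ),
    mul_nonneg (mul_nonneg ht0 ht0) (sq_nonneg (w j)), mul_nonneg ht0 (sq_nonneg (w j))]

/-- The translate of the prior on the ball of radius `2Mτ` to a centre `a` has a bounded density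
with respect to the prior on the ball of radius `R`. -/
lemma map_add_sparsityPrior_le (hM : 0 < M) (hτ : 0 < τ) (hR : 0 < R) {a : Fin M → ℝ}
    (ha : l1Norm a ≤ R - 2 * M * τ) :
    (sparsityPrior M τ (2 * M * τ)).map (a + ·) ≤
      ENNReal.ofReal (Real.exp (1 + 4 * ∑ j, Real.log (1 + τ⁻¹ * |a j|))) •
        sparsityPrior M τ R := by
  have hM' : (0 : ℝ) < M := by exact_mod_cast hM
  have hr : 0 < 2 * M * τ := by positivity
  have hC := priorConst_pos (M := M) hτ hR
  have hC' := priorConst_pos (M := M) hτ hr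
  -- The Markov bound gives the factor `2`; weakening it to `e` produces the `1` in the exponent,
  -- and eventually the term `β / (n + 1)`.
  have hCC : priorConst M τ R ≤ Real.exp 1 * priorConst M τ (2 * M * τ) := by
    refine ((priorConst_le_integral hτ).trans (integral_priorWeight_le hM hτ)).trans ?_
    gcongr
    linarith [Real.add_one_le_exp 1]
  refine Measure.le_iff.2 fun s hs => ?_
  have hms : MeasurableSet ((a + ·) ⁻¹' s) := measurable_const_add a hs
  rw [Measure.map_apply (measurable_const_add a) hs, Measure.smul_apply, smul_eq_mul,
    sparsityPrior, sparsityPrior, withDensity_apply _ hms, withDensity_apply _ hs,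
    Measure.restrict_restrict hms, Measure.restrict_restrict hs,
    ← lintegral_indicator (hms.inter (measurableSet_l1Norm_le _)),
    ← lintegral_indicator (hs.inter (measurableSet_l1Norm_le _)),
    ← lintegral_add_left_eq_self (Set.indicator (s ∩ _) _) a, ← lintegral_const_mul' _ _ ENNReal.ofReal_ne_top]
  refine lintegral_mono fun w => ?_
  dsimp only
  by_cases hw : w ∈ (a + ·) ⁻¹' s ∩ {w | l1Norm w ≤ 2 * M * τ}
  · have hw' : a + w ∈ s ∩ {w | l1Norm w ≤ R} :=
      ⟨hw.1, (l1Norm_add_le a w).trans (by linarith [hw.2.out])⟩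
    rw [Set.indicator_of_mem hw, Set.indicator_of_mem hw',
      ← ENNReal.ofReal_mul (Real.exp_pos _).le]
    refine ENNReal.ofReal_le_ofReal ?_
    have h1 := priorWeight_le_of_translate hτ a w
    have h2 := priorWeight_pos hτ (a + w)
    calc (priorConst M τ (2 * M * τ))⁻¹ * priorWeight τ w
        ≤ (Real.exp 1 * (priorConst M τ R)⁻¹) *
          (Real.exp (4 * ∑ j, Real.log (1 + τ⁻¹ * |a j|)) * priorWeight τ (a + w)) := by
          refine mul_le_mul ?_ h1 (priorWeight_pos hτ w).le (by positivity)
          rw [← div_eq_mul_inv, inv_eq_one_div, div_le_div_iff₀ hC' hC]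
          linarith
      _ = _ := by rw [Real.exp_add]; ring
  · rw [Set.indicator_of_notMem hw]
    exact zero_le

end Prior

/-! ### Regret of exponential weighting on a fixed sequence of losses -/

section Regret

variable {W : Type*} [MeasurableSpace W]

/-- The difference of the two sides vanishes at `0` and has derivative `-1 + y + exp (-y) ≥ 0`.
Because losses are nonnegative, this keeps any exponential factor out of the second order term. -/
lemma exp_neg_le_quadratic {x : ℝ} (hx : 0 ≤ x) : Real.exp (-x) ≤ 1 - x + x ^ 2 / 2 := by
  have hd : ∀ y : ℝ, HasDerivAt (fun y : ℝ => 1 - y + y ^ 2 / 2 - Real.exp (-y))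
      (-1 + y + Real.exp (-y)) y := fun y => by
    have h1 := ((hasDerivAt_id y).const_sub 1).add ((hasDerivAt_pow 2 y).div_const 2)
    refine (h1.sub (hasDerivAt_neg y).exp).congr_deriv ?_
    simp
  have hmono : Monotone fun y : ℝ => 1 - y + y ^ 2 / 2 - Real.exp (-y) :=
    monotone_of_hasDerivAt_nonneg hd fun y => by
      have := Real.add_one_le_exp (-y); simp only [Pi.zero_apply]; linarith
  have := hmono hx
  simp at this
  linarith

/-- One step of exponential weighting: the log-partition function decreases by at least the
posterior mean of the loss, up to a second order term. -/
lemma log_integral_mul_exp_le {π : Measure W} {B β : ℝ} (hβ : 0 < β)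
    {E a : W → ℝ} (hE : Integrable E π) (hE0 : ∀ w, 0 ≤ E w) (hEpos : 0 < ∫ w, E w ∂π)
    (ha : Measurable a) (haB : ∀ᵐ w ∂π, a w ∈ Set.Icc 0 B)
    (hpos : 0 < ∫ w, E w * Real.exp (-(1 / β) * a w) ∂π) :
    (∫ w, a w * E w ∂π) / ∫ w, E w ∂π ≤
      β * (Real.log (∫ w, E w ∂π) - Real.log (∫ w, E w * Real.exp (-(1 / β) * a w) ∂π))
        + B ^ 2 / (2 * β) := by
  set V := ∫ w, E w ∂π
  set V' := ∫ w, E w * Real.exp (-(1 / β) * a w) ∂π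
  set A := ∫ w, a w * E w ∂π
  have hiA : Integrable (fun w => a w * E w) π :=
    hE.bdd_mul (c := B) ha.aestronglyMeasurable (haB.mono fun w hw => by
      rw [Real.norm_of_nonneg hw.1]; exact hw.2)
  have hi2 : Integrable (fun w => E w * Real.exp (-(1 / β) * a w)) π := by
    refine hE.mul_bdd (c := 1) (by fun_prop) (haB.mono fun w hw => ?_)
    rw [Real.norm_of_nonneg (Real.exp_pos _).le, Real.exp_le_one_iff]
    have := hw.1
    have : 0 ≤ 1 / β * a w := by positivity
    linarith
  have hle : V' ≤ V - (1 / β) * A + B ^ 2 / (2 * β ^ 2) * V := by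
    calc V' ≤ ∫ w, (E w - (1 / β) * (a w * E w) + B ^ 2 / (2 * β ^ 2) * E w) ∂π := by
          refine integral_mono_ae hi2 ((hE.sub (hiA.const_mul _)).add (hE.const_mul _))
            (haB.mono fun w hw => ?_)
          dsimp only
          have h0 := hw.1
          have h1 := exp_neg_le_quadratic (x := 1 / β * a w) (by positivity)
          have h2 : (1 / β * a w) ^ 2 / 2 ≤ B ^ 2 / (2 * β ^ 2) := by
            have : a w ^ 2 ≤ B ^ 2 := by gcongr; exact hw.2
            calc (1 / β * a w) ^ 2 / 2 = a w ^ 2 / (2 * β ^ 2) := by field_simp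
              _ ≤ _ := by gcongr
          rw [neg_mul]
          nlinarith [mul_le_mul_of_nonneg_left (h1.trans (add_le_add_right h2 _)) (hE0 w)]
      _ = _ := by
          rw [integral_add (f := fun w => E w - 1 / β * (a w * E w)) (hE.sub (hiA.const_mul _))
            (hE.const_mul _),
            integral_sub hE (hiA.const_mul _), integral_const_mul, integral_const_mul]
  -- Uses `log x ≤ x - 1` at `x = V' / V`.
  have hlog : Real.log V' - Real.log V ≤ -(1 / β) * (A / V) + B ^ 2 / (2 * β ^ 2) := by
    rw [← Real.log_div hpos.ne' hEpos.ne']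
    refine (Real.log_le_sub_one_of_pos (by positivity)).trans ?_
    rw [sub_le_iff_le_add, div_le_iff₀ hEpos]
    refine hle.trans (le_of_eq ?_)
    field_simp
    ring
  have := mul_le_mul_of_nonneg_left hlog hβ.le
  have e1 : β * (-(1 / β) * (A / V) + B ^ 2 / (2 * β ^ 2)) = -(A / V) + B ^ 2 / (2 * β) := by
    field_simp
  rw [e1] at this
  linarith

/-- The regret bound for exponential weighting with bounded losses, relative to a comparison
measure `ρ` with bounded density. -/
theorem exp_weights_regret {π ρ : Measure W} [IsProbabilityMeasure π] [IsProbabilityMeasure ρ]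
    {K B β : ℝ} (hβ : 0 < β) (hρ : ρ ≤ ENNReal.ofReal (Real.exp K) • π) {N : ℕ}
    (a : Fin N → W → ℝ) (ha : ∀ i, Measurable (a i))
    (haB : ∀ i, ∀ᵐ w ∂π, a i w ∈ Set.Icc 0 B) :
    ∑ m : Fin N,
      (∫ w, a m w * Real.exp (-(1 / β) * ∑ i : Fin N with i.val < m.val, a i w) ∂π) /
        (∫ w, Real.exp (-(1 / β) * ∑ i : Fin N with i.val < m.val, a i w) ∂π) ≤
      ∑ i, ∫ w, a i w ∂ρ + β * K + N * (B ^ 2 / (2 * β)) := by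
  set E : ℕ → W → ℝ := fun m w => Real.exp (-(1 / β) * ∑ i : Fin N with i.val < m, a i w)
    with hEdef
  have hall : ∀ᵐ w ∂π, ∀ i, a i w ∈ Set.Icc 0 B := ae_all_iff.2 haB
  have hEm : ∀ m, Measurable (E m) := fun m =>
    (Measurable.const_mul (Finset.measurable_sum _ fun i _ => ha i) _).exp
  have hEi : ∀ m, Integrable (E m) π := fun m =>
    Integrable.of_bound (hEm m).aestronglyMeasurable 1 (hall.mono fun w hw => by
      rw [Real.norm_of_nonneg (Real.exp_pos _).le, Real.exp_le_one_iff]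
      have : 0 ≤ ∑ i : Fin N with i.val < m, a i w := Finset.sum_nonneg fun i _ => (hw i).1
      have : 0 ≤ 1 / β * ∑ i : Fin N with i.val < m, a i w := by positivity
      linarith)
  have hEpos : ∀ m, 0 < ∫ w, E m w ∂π := fun m => integral_exp_pos (hEi m)
  have hsucc : ∀ (m : Fin N) (w : W), E (m.val + 1) w = E m w * Real.exp (-(1 / β) * a m w) := by
    intro m w
    have : (Finset.univ.filter fun i : Fin N => i.val < m.val + 1) =
        insert m (Finset.univ.filter fun i : Fin N => i.val < m.val) := by
      ext i
      simp only [Finset.mem_filter, Finset.mem_univ, true_and, Finset.mem_insert, Fin.ext_iff]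
      omega
    simp only [hEdef]
    rw [this, Finset.sum_insert (by simp), ← Real.exp_add]
    ring_nf
  have hstep : ∀ m : Fin N, (∫ w, a m w * E m w ∂π) / (∫ w, E m w ∂π) ≤
      β * (Real.log (∫ w, E m w ∂π) - Real.log (∫ w, E (m.val + 1) w ∂π))
        + B ^ 2 / (2 * β) := fun m => by
    have h := hEpos (m.val + 1)
    simp only [hsucc] at h ⊢
    exact log_integral_mul_exp_le hβ (hEi m) (fun w => (Real.exp_pos _).le) (hEpos m) (ha m)
      (haB m) h
  -- The sum telescopes, and the initial term is `log 1 = 0` because `π` is a probability measure.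
  have hsum : ∑ m : Fin N, (Real.log (∫ w, E m w ∂π) - Real.log (∫ w, E (m.val + 1) w ∂π)) =
      -Real.log (∫ w, E N w ∂π) := by
    rw [Fin.sum_univ_eq_sum_range
      (fun m => Real.log (∫ w, E m w ∂π) - Real.log (∫ w, E (m + 1) w ∂π)), Finset.sum_range_sub']
    simp [hEdef]
  have hac : ρ ≪ π := (Measure.absolutelyContinuous_of_le hρ).trans Measure.smul_absolutelyContinuous
  have hallρ : ∀ᵐ w ∂ρ, ∀ i, a i w ∈ Set.Icc 0 B := hac.ae_le hall
  have hai : ∀ i, Integrable (a i) ρ := fun i =>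
    Integrable.of_bound (ha i).aestronglyMeasurable B (hallρ.mono fun w hw => by
      rw [Real.norm_of_nonneg (hw i).1]; exact (hw i).2)
  have hEN : ∀ w, E N w = Real.exp (-(1 / β) * ∑ i, a i w) := fun w => by simp [hEdef]
  -- This plays the role of the Gibbs variational inequality: the density bound moves from `π` to
  -- `ρ` at cost `exp K`, and Jensen pulls the `ρ`-mean into the exponent. No relative entropy is
  -- needed.
  have hfinal : -Real.log (∫ w, E N w ∂π) ≤ (1 / β) * ∑ i, ∫ w, a i w ∂ρ + K := by
    have h1 : ∫ w, E N w ∂ρ ≤ Real.exp K * ∫ w, E N w ∂π := by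
      have h := integral_mono_measure hρ (ae_of_all _ fun w => (Real.exp_pos _).le)
        ((hEi N).smul_measure ENNReal.ofReal_ne_top)
      rwa [integral_smul_measure, ENNReal.toReal_ofReal (Real.exp_pos _).le, smul_eq_mul] at h
    have h2 : Real.exp (∫ w, -(1 / β) * ∑ i, a i w ∂ρ) ≤ ∫ w, E N w ∂ρ := by
      simp only [hEN]
      refine convexOn_exp.map_integral_le Real.continuous_exp.continuousOn isClosed_univ
        (by simp) ((integrable_finsetSum _ fun i _ => hai i).const_mul _) ?_
      have h3 : Integrable (E N) ρ := ((hEi N).smul_measure ENNReal.ofReal_ne_top).mono_measure hρ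
      exact h3.congr (ae_of_all _ fun w => hEN w)
    rw [integral_const_mul, integral_finsetSum _ fun i _ => hai i] at h2
    have h4 := Real.log_le_log (Real.exp_pos _) (h2.trans h1)
    rw [Real.log_exp, Real.log_mul (Real.exp_pos _).ne' (hEpos N).ne', Real.log_exp] at h4
    linarith
  calc _ ≤ ∑ m : Fin N, (β * (Real.log (∫ w, E m w ∂π) - Real.log (∫ w, E (m.val + 1) w ∂π))
        + B ^ 2 / (2 * β)) := Finset.sum_le_sum fun m _ => hstep m
    _ = β * -Real.log (∫ w, E N w ∂π) + N * (B ^ 2 / (2 * β)) := by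
        rw [Finset.sum_add_distrib, ← Finset.mul_sum, hsum]; simp
    _ ≤ β * ((1 / β) * ∑ i, ∫ w, a i w ∂ρ + K) + N * (B ^ 2 / (2 * β)) := by gcongr
    _ = _ := by field_simp

end Regret

/-! ### The hinge loss and the risk of linear combinations -/

lemma hinge_nonneg (u : ℝ) : 0 ≤ hinge u := le_max_right _ _

lemma continuous_hinge : Continuous hinge := by unfold hinge; fun_prop

lemma hinge_le_add_abs_sub (u v : ℝ) : hinge u ≤ hinge v + |u - v| := by
  have h1 := le_abs_self (u - v)
  exact max_le (by linarith [le_max_left (1 + v) 0, show hinge v = max (1 + v) 0 from rfl])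
    (add_nonneg (hinge_nonneg v) (abs_nonneg _))

lemma abs_label (y : Label) : |(y : ℝ)| = 1 := by
  rcases y.2 with h | h
  · rw [h]; simp
  · rw [Set.mem_singleton_iff.1 h]; simp

section Risk

variable {X : Type*} {M : ℕ} {φ : Fin M → X → ℝ} {L R β : ℝ}

lemma linComb_add (v w : Fin M → ℝ) (x : X) :
    linComb φ (v + w) x = linComb φ v x + linComb φ w x := by
  simp [linComb, add_mul, Finset.sum_add_distrib]

lemma abs_linComb_le {x : X} (hx : ∀ j, |φ j x| ≤ L) (w : Fin M → ℝ) :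
    |linComb φ w x| ≤ l1Norm w * L := by
  rw [linComb, l1Norm, Finset.sum_mul]
  refine (Finset.abs_sum_le_sum_abs _ _).trans (Finset.sum_le_sum fun j _ => ?_)
  rw [abs_mul]
  exact mul_le_mul_of_nonneg_left (hx j) (abs_nonneg _)

lemma pointLoss_nonneg (z : X × Label) (g : X → ℝ) : 0 ≤ pointLoss hinge z g := hinge_nonneg _

/-- The hinge function is 1-Lipschitz and labels have modulus one. -/
lemma pointLoss_le (z : X × Label) (g h : X → ℝ) :
    pointLoss hinge z g ≤ pointLoss hinge z h + |g z.1 - h z.1| := by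
  refine (hinge_le_add_abs_sub _ (-(z.2 : ℝ) * h z.1)).trans (le_of_eq ?_)
  rw [← mul_sub, abs_mul, abs_neg, abs_label, one_mul, pointLoss]

lemma pointLoss_linComb_le {z : X × Label} (hz : ∀ j, |φ j z.1| ≤ L) (w : Fin M → ℝ) :
    pointLoss hinge z (linComb φ w) ≤ 1 + l1Norm w * L := by
  refine (pointLoss_le z _ 0).trans ?_
  have h0 : pointLoss hinge z 0 = 1 := by simp [pointLoss, hinge]
  rw [h0, Pi.zero_apply, sub_zero]
  exact add_le_add_right (abs_linComb_le hz w) 1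

lemma pointLoss_linComb_mem_Icc (hL : 0 ≤ L) {z : X × Label} (hz : ∀ j, |φ j z.1| ≤ L)
    {w : Fin M → ℝ} (hw : l1Norm w ≤ R) :
    pointLoss hinge z (linComb φ w) ∈ Set.Icc 0 (1 + R * L) :=
  ⟨pointLoss_nonneg _ _, (pointLoss_linComb_le hz w).trans (by gcongr)⟩

variable [MeasurableSpace X]

lemma measurable_pointLoss (hφ : ∀ j, Measurable (φ j)) :
    Measurable fun p : (X × Label) × (Fin M → ℝ) => pointLoss hinge p.1 (linComb φ p.2) := by
  have : ∀ j, Measurable fun p : (X × Label) × (Fin M → ℝ) => φ j p.1.1 :=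
    fun j => (hφ j).comp (measurable_fst.comp measurable_fst)
  have h2 : Measurable fun p : (X × Label) × (Fin M → ℝ) => (p.1.2 : ℝ) :=
    measurable_subtype_coe.comp (measurable_snd.comp measurable_fst)
  unfold pointLoss linComb
  refine continuous_hinge.measurable.comp (h2.neg.mul ?_)
  exact Finset.measurable_sum _ fun j _ =>
    ((measurable_pi_apply j).comp measurable_snd).mul (this j)

variable {P : Measure (X × Label)}

/-- Finitely many null sets are discarded at once, so that later estimates can be made pointwise at
a good observation. -/
lemma ae_abs_le_of_eLpNorm_top_le (hL : 0 ≤ L)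
    (h : ∀ j, eLpNorm (φ j) ⊤ (P.map Prod.fst) ≤ ENNReal.ofReal L) :
    ∀ᵐ z ∂P, ∀ j, |φ j z.1| ≤ L := by
  refine ae_all_iff.2 fun j => ?_
  refine ae_of_ae_map (p := fun x => |φ j x| ≤ L) measurable_fst.aemeasurable ?_
  have h1 := h j
  rw [eLpNorm_exponent_top] at h1
  filter_upwards [enorm_ae_le_eLpNormEssSup (φ j) (P.map Prod.fst)] with x hx
  have h2 := hx.trans h1
  rwa [Real.enorm_eq_ofReal_abs, ENNReal.ofReal_le_ofReal_iff hL] at h2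

variable [IsProbabilityMeasure P]

lemma integrable_pointLoss (hφ : ∀ j, Measurable (φ j)) (hP : ∀ᵐ z ∂P, ∀ j, |φ j z.1| ≤ L)
    (w : Fin M → ℝ) : Integrable (fun z => pointLoss hinge z (linComb φ w)) P :=
  Integrable.of_bound
    ((measurable_pointLoss hφ).comp (measurable_id.prodMk measurable_const)).aestronglyMeasurable
    (1 + l1Norm w * L) (hP.mono fun z hz => by
      rw [Real.norm_of_nonneg (pointLoss_nonneg _ _)]
      exact pointLoss_linComb_le hz w)

lemma phiRisk_sub_le (hφ : ∀ j, Measurable (φ j)) (hP : ∀ᵐ z ∂P, ∀ j, |φ j z.1| ≤ L)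
    (v w : Fin M → ℝ) :
    phiRisk hinge P (linComb φ v) - phiRisk hinge P (linComb φ w) ≤ l1Norm (v - w) * L := by
  rw [phiRisk, phiRisk, ← integral_sub (integrable_pointLoss hφ hP v) (integrable_pointLoss hφ hP w)]
  calc _ ≤ ∫ _, l1Norm (v - w) * L ∂P := by
        refine integral_mono_ae ((integrable_pointLoss hφ hP v).sub
          (integrable_pointLoss hφ hP w)) (integrable_const _) (hP.mono fun z hz => ?_)
        have h1 := pointLoss_le z (linComb φ v) (linComb φ w)
        have h2 := abs_linComb_le hz (v - w)
        have h3 := linComb_add (φ := φ) (v - w) w z.1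
        rw [sub_add_cancel] at h3
        rw [h3, add_sub_cancel_right] at h1
        dsimp only
        linarith
    _ = _ := by simp

lemma continuous_phiRisk_linComb (hφ : ∀ j, Measurable (φ j))
    (hP : ∀ᵐ z ∂P, ∀ j, |φ j z.1| ≤ L) :
    Continuous fun w : Fin M → ℝ => phiRisk hinge P (linComb φ w) := by
  refine continuous_iff_continuousAt.2 fun w => ?_
  rw [ContinuousAt, tendsto_iff_norm_sub_tendsto_zero]
  have hlim : Filter.Tendsto (fun v : Fin M → ℝ => l1Norm (v - w) * L) (nhds w) (nhds 0) := by
    have h : Continuous fun v : Fin M → ℝ => l1Norm (v - w) * L :=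
      (continuous_l1Norm.comp (continuous_id.sub continuous_const)).mul continuous_const
    simpa [l1Norm] using h.tendsto w
  refine squeeze_zero (fun _ => norm_nonneg _) (fun v => ?_) hlim
  have h1 := phiRisk_sub_le hφ hP v w
  have h2 := phiRisk_sub_le hφ hP w v
  have h3 : l1Norm (w - v) = l1Norm (v - w) := by simp [l1Norm, abs_sub_comm]
  rw [h3] at h2
  exact abs_le.2 ⟨by linarith, h1⟩

end Risk

/-! ### The mirror averaging posterior and the general oracle inequality -/

section Density

variable {X : Type*} [MeasurableSpace X] {M n : ℕ} {φ : Fin M → X → ℝ} {R β : ℝ}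
  {π : Measure (Fin M → ℝ)} [IsProbabilityMeasure π]

lemma measurable_expWeight (hφ : ∀ j, Measurable (φ j)) (m : ℕ) :
    Measurable fun p : (Fin n → X × Label) × (Fin M → ℝ) =>
      expWeight (pointLoss hinge) φ β p.1 m p.2 := by
  unfold expWeight
  refine (Measurable.const_mul (Finset.measurable_sum _ fun i _ => ?_) _).exp
  have h : Measurable fun p : (Fin n → X × Label) × (Fin M → ℝ) => (p.1 i, p.2) :=
    ((measurable_pi_apply i).comp measurable_fst).prodMk measurable_snd
  exact (measurable_pointLoss hφ).comp h

lemma expWeight_le_one {Y : Type*} {φ : Fin M → Y → ℝ} (hβ : 0 < β) (Z : Fin n → Y × Label)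
    (m : ℕ) (w : Fin M → ℝ) : expWeight (pointLoss hinge) φ β Z m w ≤ 1 := by
  rw [expWeight, Real.exp_le_one_iff]
  have : 0 ≤ ∑ i : Fin n with i.val < m, pointLoss hinge (Z i) (linComb φ w) :=
    Finset.sum_nonneg fun _ _ => pointLoss_nonneg _ _
  have : 0 ≤ 1 / β * ∑ i : Fin n with i.val < m, pointLoss hinge (Z i) (linComb φ w) := by
    positivity
  linarith

lemma integrable_expWeight (hβ : 0 < β) (hφ : ∀ j, Measurable (φ j)) (Z : Fin n → X × Label)
    (m : ℕ) : Integrable (expWeight (pointLoss hinge) φ β Z m) π :=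
  Integrable.of_bound ((measurable_expWeight hφ m).comp
    (measurable_const.prodMk measurable_id)).aestronglyMeasurable 1 (ae_of_all _ fun w => by
      rw [expWeight, Real.norm_of_nonneg (Real.exp_pos _).le]
      exact expWeight_le_one hβ Z m w)

lemma integral_expWeight_pos (hβ : 0 < β) (hφ : ∀ j, Measurable (φ j)) (Z : Fin n → X × Label)
    (m : ℕ) : 0 < ∫ w, expWeight (pointLoss hinge) φ β Z m w ∂π :=
  integral_exp_pos (integrable_expWeight hβ hφ Z m)

lemma measurable_posteriorDensity (hφ : ∀ j, Measurable (φ j)) (m : ℕ) :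
    Measurable fun p : (Fin n → X × Label) × (Fin M → ℝ) =>
      posteriorDensity (pointLoss hinge) φ π β p.1 m p.2 := by
  have h : Measurable fun Z : Fin n → X × Label =>
      ∫ w, expWeight (pointLoss hinge) φ β Z m w ∂π :=
    (StronglyMeasurable.integral_prod_right
      (measurable_expWeight (β := β) hφ m).stronglyMeasurable).measurable
  exact (measurable_expWeight hφ m).div (h.comp measurable_fst)

lemma posteriorDensity_nonneg {Y : Type*} {φ : Fin M → Y → ℝ} {π : Measure (Fin M → ℝ)}
    (Z : Fin n → Y × Label) (m : ℕ) (w : Fin M → ℝ) :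
    0 ≤ posteriorDensity (pointLoss hinge) φ π β Z m w :=
  div_nonneg (Real.exp_pos _).le (integral_nonneg fun _ => (Real.exp_pos _).le)

lemma integrable_posteriorDensity (hβ : 0 < β) (hφ : ∀ j, Measurable (φ j))
    (Z : Fin n → X × Label) (m : ℕ) :
    Integrable (posteriorDensity (pointLoss hinge) φ π β Z m) π :=
  (integrable_expWeight hβ hφ Z m).div_const _

lemma integral_posteriorDensity (hβ : 0 < β) (hφ : ∀ j, Measurable (φ j))
    (Z : Fin n → X × Label) (m : ℕ) :
    ∫ w, posteriorDensity (pointLoss hinge) φ π β Z m w ∂π = 1 := by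
  simp only [posteriorDensity]
  rw [integral_div, div_self (integral_expWeight_pos hβ hφ Z m).ne']

lemma measurable_maDensity (hφ : ∀ j, Measurable (φ j)) :
    Measurable fun p : (Fin n → X × Label) × (Fin M → ℝ) =>
      maDensity (pointLoss hinge) φ π β p.1 p.2 :=
  Measurable.const_mul (Finset.measurable_sum _ fun m _ => measurable_posteriorDensity hφ m) _

lemma maDensity_nonneg {Y : Type*} {φ : Fin M → Y → ℝ} {π : Measure (Fin M → ℝ)}
    (Z : Fin n → Y × Label) (w : Fin M → ℝ) :
    0 ≤ maDensity (pointLoss hinge) φ π β Z w :=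
  mul_nonneg (by positivity) (Finset.sum_nonneg fun m _ => posteriorDensity_nonneg Z m w)

lemma integrable_maDensity (hβ : 0 < β) (hφ : ∀ j, Measurable (φ j)) (Z : Fin n → X × Label) :
    Integrable (maDensity (pointLoss hinge) φ π β Z) π :=
  (integrable_finsetSum _ fun m _ => integrable_posteriorDensity hβ hφ Z m).const_mul _

lemma integral_maDensity (hβ : 0 < β) (hφ : ∀ j, Measurable (φ j)) (Z : Fin n → X × Label) :
    ∫ w, maDensity (pointLoss hinge) φ π β Z w ∂π = 1 := by
  simp only [maDensity]
  rw [integral_const_mul, integral_finsetSum _ fun m _ => integrable_posteriorDensity hβ hφ Z m]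
  simp only [integral_posteriorDensity hβ hφ, Finset.sum_const, Finset.card_range, nsmul_eq_mul,
    mul_one]
  push_cast
  field_simp

/-- The mean of the `j`-th coordinate under the mirror averaging posterior. -/
noncomputable def maCoeff (φ : Fin M → X → ℝ) (π : Measure (Fin M → ℝ)) (β : ℝ)
    (Z : Fin n → X × Label) (j : Fin M) : ℝ :=
  ∫ w, w j * maDensity (pointLoss hinge) φ π β Z w ∂π

lemma integrable_coord_mul_maDensity (hβ : 0 < β) (hφ : ∀ j, Measurable (φ j))
    (hπ : ∀ᵐ w ∂π, l1Norm w ≤ R) (Z : Fin n → X × Label) (j : Fin M) :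
    Integrable (fun w => w j * maDensity (pointLoss hinge) φ π β Z w) π :=
  (integrable_maDensity hβ hφ Z).bdd_mul (c := R) (measurable_pi_apply j).aestronglyMeasurable
    (hπ.mono fun w hw => (abs_le_l1Norm w j).trans hw)

/-- With this, the risk of the aggregate is a continuous function on a compact ball evaluated at a
measurable coefficient vector, which settles measurability and integrability. -/
lemma maAggregate_eq_linComb (hβ : 0 < β) (hφ : ∀ j, Measurable (φ j))
    (hπ : ∀ᵐ w ∂π, l1Norm w ≤ R) (Z : Fin n → X × Label) :
    maAggregate (pointLoss hinge) φ π β Z = linComb φ (maCoeff φ π β Z) := by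
  ext x
  simp only [maAggregate, linComb, maCoeff, Finset.sum_mul]
  have h : ∀ (j : Fin M) (w : Fin M → ℝ), w j * φ j x * maDensity (pointLoss hinge) φ π β Z w =
      w j * maDensity (pointLoss hinge) φ π β Z w * φ j x := fun j w => by ring
  simp only [h]
  rw [integral_finsetSum _ fun j _ =>
    (integrable_coord_mul_maDensity hβ hφ hπ Z j).mul_const (φ j x)]
  simp only [integral_mul_const]

lemma l1Norm_maCoeff_le (hβ : 0 < β) (hφ : ∀ j, Measurable (φ j))
    (hπ : ∀ᵐ w ∂π, l1Norm w ≤ R) (Z : Fin n → X × Label) : l1Norm (maCoeff φ π β Z) ≤ R := by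
  have hi : ∀ j : Fin M, Integrable
      (fun w => |w j * maDensity (pointLoss hinge) φ π β Z w|) π := fun j =>
    (integrable_coord_mul_maDensity hβ hφ hπ Z j).abs
  calc l1Norm (maCoeff φ π β Z)
      ≤ ∑ j, ∫ w, |w j * maDensity (pointLoss hinge) φ π β Z w| ∂π :=
        Finset.sum_le_sum fun j _ => abs_integral_le_integral_abs
    _ = ∫ w, ∑ j, |w j * maDensity (pointLoss hinge) φ π β Z w| ∂π :=
        (integral_finsetSum _ fun j _ => hi j).symm
    _ ≤ ∫ w, R * maDensity (pointLoss hinge) φ π β Z w ∂π := by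
        refine integral_mono_ae (integrable_finsetSum _ fun j _ => hi j)
          ((integrable_maDensity hβ hφ Z).const_mul R) (hπ.mono fun w hw => ?_)
        have h0 := maDensity_nonneg (φ := φ) (π := π) (β := β) Z w
        simp only [abs_mul, abs_of_nonneg h0, ← Finset.sum_mul]
        exact mul_le_mul_of_nonneg_right hw h0
    _ = R := by rw [integral_const_mul, integral_maDensity hβ hφ, mul_one]

lemma measurable_maCoeff (hφ : ∀ j, Measurable (φ j)) :
    Measurable (maCoeff φ π β : (Fin n → X × Label) → Fin M → ℝ) := by
  refine measurable_pi_lambda _ fun j => ?_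
  refine (StronglyMeasurable.integral_prod_right (f := fun (Z : Fin n → X × Label) w =>
    w j * maDensity (pointLoss hinge) φ π β Z w) ?_).measurable
  exact (((measurable_pi_apply j).comp measurable_snd).mul
    (measurable_maDensity hφ)).stronglyMeasurable

variable {L : ℝ} {P : Measure (X × Label)} [IsProbabilityMeasure P]

lemma integrable_phiRisk_maAggregate (hβ : 0 < β) (hφ : ∀ j, Measurable (φ j))
    (hπ : ∀ᵐ w ∂π, l1Norm w ≤ R) (hP : ∀ᵐ z ∂P, ∀ j, |φ j z.1| ≤ L) :
    Integrable (fun Z : Fin n → X × Label =>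
      phiRisk hinge P (maAggregate (pointLoss hinge) φ π β Z)) (Measure.pi fun _ => P) := by
  simp only [maAggregate_eq_linComb hβ hφ hπ]
  have hc := continuous_phiRisk_linComb hφ hP
  obtain ⟨b, hb⟩ := (isCompact_l1Norm_le (M := M) R).exists_bound_of_continuousOn hc.continuousOn
  exact Integrable.of_bound (hc.measurable.comp (measurable_maCoeff hφ)).aestronglyMeasurable b
    (ae_of_all _ fun Z => hb _ (l1Norm_maCoeff_le hβ hφ hπ Z))

lemma integrable_pointLoss_mul {π : Measure (Fin M → ℝ)} (hL : 0 ≤ L) (hφ : ∀ j, Measurable (φ j))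
    (hπ : ∀ᵐ w ∂π, l1Norm w ≤ R) {z : X × Label} (hz : ∀ j, |φ j z.1| ≤ L)
    {d : (Fin M → ℝ) → ℝ} (hd : Integrable d π) :
    Integrable (fun w => pointLoss hinge z (linComb φ w) * d w) π :=
  hd.bdd_mul (c := 1 + R * L) ((measurable_pointLoss hφ).comp
    (measurable_const.prodMk measurable_id)).aestronglyMeasurable (hπ.mono fun w hw => by
      have := pointLoss_linComb_mem_Icc hL hz hw
      rw [Real.norm_of_nonneg this.1]; exact this.2)

/-- Jensen's inequality for the hinge loss and the mirror averaging posterior. -/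
lemma pointLoss_maAggregate_le (hL : 0 ≤ L) (hβ : 0 < β) (hφ : ∀ j, Measurable (φ j))
    (hπ : ∀ᵐ w ∂π, l1Norm w ≤ R) (Z : Fin n → X × Label) {z : X × Label}
    (hz : ∀ j, |φ j z.1| ≤ L) :
    pointLoss hinge z (maAggregate (pointLoss hinge) φ π β Z) ≤
      ∫ w, pointLoss hinge z (linComb φ w) * maDensity (pointLoss hinge) φ π β Z w ∂π := by
  have hd := integrable_maDensity (π := π) hβ hφ Z
  have hi := integrable_pointLoss_mul hL hφ hπ hz hd
  have hlin : Integrable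
      (fun w => linComb φ w z.1 * maDensity (pointLoss hinge) φ π β Z w) π := by
    refine hd.bdd_mul (c := R * L) ?_ (hπ.mono fun w hw =>
      (abs_linComb_le hz w).trans (by gcongr))
    have : Continuous fun w : Fin M → ℝ => linComb φ w z.1 := by unfold linComb; fun_prop
    exact this.aestronglyMeasurable
  -- Jensen is done by hand: each of the two affine pieces of the hinge is compared with the
  -- integral, using that the posterior density has total mass one.
  refine max_le ?_ (integral_nonneg fun w =>
    mul_nonneg (pointLoss_nonneg _ _) (maDensity_nonneg Z w))
  calc 1 + -(z.2 : ℝ) * maAggregate (pointLoss hinge) φ π β Z z.1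
      = ∫ w, (maDensity (pointLoss hinge) φ π β Z w + -(z.2 : ℝ) *
          (linComb φ w z.1 * maDensity (pointLoss hinge) φ π β Z w)) ∂π := by
        rw [integral_add hd (hlin.const_mul _), integral_const_mul, integral_maDensity hβ hφ,
          maAggregate]
    _ ≤ _ := by
        refine integral_mono (hd.add (hlin.const_mul _)) hi fun w => ?_
        have h0 := maDensity_nonneg (φ := φ) (π := π) (β := β) Z w
        have h1 : 1 + -(z.2 : ℝ) * linComb φ w z.1 ≤ pointLoss hinge z (linComb φ w) :=
          le_max_left _ _
        have := mul_le_mul_of_nonneg_right h1 h0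
        dsimp only
        linarith

/-- The posterior mean of the loss at a new observation `z`, given the first `m` observations. -/
noncomputable def posteriorLoss (φ : Fin M → X → ℝ) (π : Measure (Fin M → ℝ)) (β : ℝ) (m : ℕ)
    (z : X × Label) (Z : Fin n → X × Label) : ℝ :=
  ∫ w, pointLoss hinge z (linComb φ w) * posteriorDensity (pointLoss hinge) φ π β Z m w ∂π

lemma integrable_posteriorLoss (hL : 0 ≤ L) (hβ : 0 < β) (hφ : ∀ j, Measurable (φ j))
    (hπ : ∀ᵐ w ∂π, l1Norm w ≤ R) (hP : ∀ᵐ z ∂P, ∀ j, |φ j z.1| ≤ L) (m : ℕ) :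
    Integrable (fun p : (X × Label) × (Fin n → X × Label) => posteriorLoss φ π β m p.1 p.2)
      (P.prod (Measure.pi fun _ => P)) := by
  refine Integrable.of_bound (C := 1 + R * L) ?_ ?_
  · refine (StronglyMeasurable.integral_prod_right
      (f := fun (p : (X × Label) × (Fin n → X × Label)) w => pointLoss hinge p.1 (linComb φ w) *
        posteriorDensity (pointLoss hinge) φ π β p.2 m w) ?_).aestronglyMeasurable
    have h1 : Measurable fun q : ((X × Label) × (Fin n → X × Label)) × (Fin M → ℝ) =>
        (q.1.1, q.2) := (measurable_fst.comp measurable_fst).prodMk measurable_snd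
    have h2 : Measurable fun q : ((X × Label) × (Fin n → X × Label)) × (Fin M → ℝ) =>
        (q.1.2, q.2) := (measurable_snd.comp measurable_fst).prodMk measurable_snd
    exact (((measurable_pointLoss hφ).comp h1).mul
      ((measurable_posteriorDensity (π := π) (β := β) hφ m).comp h2)).stronglyMeasurable
  · filter_upwards [Measure.quasiMeasurePreserving_fst.ae hP] with p hp
    have hd := integrable_posteriorDensity (π := π) hβ hφ p.2 m
    rw [posteriorLoss, Real.norm_of_nonneg (integral_nonneg fun w =>
      mul_nonneg (pointLoss_nonneg _ _) (posteriorDensity_nonneg p.2 m w))]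
    calc _ ≤ ∫ w, (1 + R * L) * posteriorDensity (pointLoss hinge) φ π β p.2 m w ∂π := by
          refine integral_mono_ae (integrable_pointLoss_mul hL hφ hπ hp hd)
            (hd.const_mul _) (hπ.mono fun w hw => ?_)
          exact mul_le_mul_of_nonneg_right (pointLoss_linComb_mem_Icc hL hp hw).2
            (posteriorDensity_nonneg p.2 m w)
      _ = _ := by rw [integral_const_mul, integral_posteriorDensity hβ hφ, mul_one]

lemma integral_phiRisk_maAggregate_le (hL : 0 ≤ L) (hβ : 0 < β) (hφ : ∀ j, Measurable (φ j))
    (hπ : ∀ᵐ w ∂π, l1Norm w ≤ R) (hP : ∀ᵐ z ∂P, ∀ j, |φ j z.1| ≤ L) :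
    ∫ Z : Fin n → X × Label, phiRisk hinge P (maAggregate (pointLoss hinge) φ π β Z)
        ∂(Measure.pi fun _ => P) ≤
      1 / ((n : ℝ) + 1) * ∑ m ∈ Finset.range (n + 1),
        ∫ p : (X × Label) × (Fin n → X × Label), posteriorLoss φ π β m p.1 p.2
          ∂(P.prod (Measure.pi fun _ => P)) := by
  have hint := integrable_posteriorLoss (n := n) hL hβ hφ hπ hP
  set F : (X × Label) × (Fin n → X × Label) → ℝ := fun p =>
    1 / ((n : ℝ) + 1) * ∑ m ∈ Finset.range (n + 1), posteriorLoss φ π β m p.1 p.2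
  have hF : Integrable F (P.prod (Measure.pi fun _ => P)) :=
    (integrable_finsetSum _ fun m _ => hint m).const_mul _
  calc _ ≤ ∫ Z : Fin n → X × Label, ∫ z, F (z, Z) ∂P ∂(Measure.pi fun _ => P) := by
        refine integral_mono_ae (integrable_phiRisk_maAggregate hβ hφ hπ hP)
          hF.integral_prod_right ?_
        filter_upwards [hF.prod_left_ae] with Z hZ
        refine integral_mono_ae ?_ hZ (hP.mono fun z hz => ?_)
        · rw [maAggregate_eq_linComb hβ hφ hπ]
          exact integrable_pointLoss hφ hP _
        · refine (pointLoss_maAggregate_le hL hβ hφ hπ Z hz).trans (le_of_eq ?_)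
          simp only [F, posteriorLoss]
          rw [← integral_finsetSum _ fun m _ => integrable_pointLoss_mul hL hφ hπ hz
            (integrable_posteriorDensity hβ hφ Z m), ← integral_const_mul]
          refine integral_congr_ae (ae_of_all _ fun w => ?_)
          simp only [maDensity, Finset.mul_sum]
          exact Finset.sum_congr rfl fun m _ => by ring
    _ = ∫ p, F p ∂(P.prod (Measure.pi fun _ => P)) := (integral_prod_symm F hF).symm
    _ = _ := by
        rw [integral_const_mul, integral_finsetSum _ fun m _ => hint m]

/-- The weight of index `m` uses positions strictly below `m`, and deleting position `m` shifts only
later ones. -/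
lemma expWeight_removeNth {Y : Type*} {φ : Fin M → Y → ℝ} (Z : Fin (n + 1) → Y × Label)
    (m : Fin (n + 1)) (w : Fin M → ℝ) :
    expWeight (pointLoss hinge) φ β (m.removeNth Z) m w =
      expWeight (pointLoss hinge) φ β Z m w := by
  simp only [expWeight, Finset.sum_filter]
  rw [Fin.sum_univ_succAbove _ m]
  simp only [lt_irrefl, if_false, zero_add]
  congr 2
  refine Finset.sum_congr rfl fun j _ => ?_
  have : (m.succAbove j).val < m.val ↔ j.val < m.val := by
    simp only [Fin.succAbove, Fin.lt_def, Fin.val_castSucc]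
    split_ifs with h
    · simp
    · simp; omega
  simp only [this, Fin.removeNth]

/-- Inserting the fresh observation at position `m` turns `P ⊗ Pⁿ` into `Pⁿ⁺¹` and leaves the
posterior of index `m` unchanged. This is why the aggregate averages `n + 1` posteriors, `m = 0` to
`n`. -/
lemma integral_posteriorLoss_eq {π : Measure (Fin M → ℝ)} (m : Fin (n + 1)) :
    ∫ p : (X × Label) × (Fin n → X × Label), posteriorLoss φ π β m p.1 p.2
        ∂(P.prod (Measure.pi fun _ => P)) =
      ∫ Z : Fin (n + 1) → X × Label, posteriorLoss φ π β m (Z m) Z ∂(Measure.pi fun _ => P) := by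
  rw [← (measurePreserving_piFinSuccAbove (fun _ : Fin (n + 1) => P) m).integral_comp']
  refine integral_congr_ae (ae_of_all _ fun Z => ?_)
  have : ∀ w, posteriorDensity (pointLoss hinge) φ π β (m.removeNth Z) m w =
      posteriorDensity (pointLoss hinge) φ π β Z m w := fun w => by
    simp only [posteriorDensity, expWeight_removeNth]
  simp only [MeasurableEquiv.piFinSuccAbove_apply, Fin.insertNthEquiv_symm_apply,
    posteriorLoss, this]

lemma integrable_posteriorLoss_self (hL : 0 ≤ L) (hβ : 0 < β) (hφ : ∀ j, Measurable (φ j))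
    (hπ : ∀ᵐ w ∂π, l1Norm w ≤ R) (hP : ∀ᵐ z ∂P, ∀ j, |φ j z.1| ≤ L) (m : Fin (n + 1)) :
    Integrable (fun Z : Fin (n + 1) → X × Label => posteriorLoss φ π β m (Z m) Z)
      (Measure.pi fun _ => P) := by
  have h := (measurePreserving_piFinSuccAbove (fun _ : Fin (n + 1) => P) m).integrable_comp_of_integrable
    (integrable_posteriorLoss (n := n) hL hβ hφ hπ hP m)
  refine h.congr (ae_of_all _ fun Z => ?_)
  have : ∀ w, posteriorDensity (pointLoss hinge) φ π β (m.removeNth Z) m w =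
      posteriorDensity (pointLoss hinge) φ π β Z m w := fun w => by
    simp only [posteriorDensity, expWeight_removeNth]
  simp only [Function.comp, MeasurableEquiv.piFinSuccAbove_apply, Fin.insertNthEquiv_symm_apply,
    posteriorLoss, this]

/-- The general oracle inequality for the mirror averaging aggregate: `ρ` has bounded density with
respect to the prior, and averaging over `ρ` costs at most `δ` relative to the centre `a`. -/
theorem oracle_inequality {ρ : Measure (Fin M → ℝ)} [IsProbabilityMeasure ρ] {K δ : ℝ}
    (hL : 0 ≤ L) (hβ : 0 < β) (hφ : ∀ j, Measurable (φ j)) (hπ : ∀ᵐ w ∂π, l1Norm w ≤ R)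
    (hP : ∀ᵐ z ∂P, ∀ j, |φ j z.1| ≤ L) (hρ : ρ ≤ ENNReal.ofReal (Real.exp K) • π)
    (a : Fin M → ℝ)
    (hδ : ∀ z : X × Label, (∀ j, |φ j z.1| ≤ L) →
      ∫ w, pointLoss hinge z (linComb φ w) ∂ρ ≤ pointLoss hinge z (linComb φ a) + δ) :
    ∫ Z : Fin n → X × Label, phiRisk hinge P (maAggregate (pointLoss hinge) φ π β Z)
        ∂(Measure.pi fun _ => P) ≤
      phiRisk hinge P (linComb φ a) + δ + β * K / (n + 1) + (1 + R * L) ^ 2 / (2 * β) := by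
  set B := 1 + R * L with hB
  refine (integral_phiRisk_maAggregate_le hL hβ hφ hπ hP).trans ?_
  rw [Finset.sum_range fun m => ∫ p : (X × Label) × (Fin n → X × Label),
    posteriorLoss φ π β m p.1 p.2 ∂(P.prod (Measure.pi fun _ => P))]
  simp only [integral_posteriorLoss_eq]
  -- Almost surely every observation is good, so the pathwise regret bound applies with `B = 1 +
  -- RL`.
  have hgood : ∀ᵐ Z : Fin (n + 1) → X × Label ∂(Measure.pi fun _ => P),
      ∀ i j, |φ j (Z i).1| ≤ L :=
    ae_all_iff.2 fun i => (Measure.tendsto_eval_ae_ae (μ := fun _ : Fin (n + 1) => P)).eventually hP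
  have heval : ∀ i : Fin (n + 1), Integrable (fun Z : Fin (n + 1) → X × Label =>
      pointLoss hinge (Z i) (linComb φ a)) (Measure.pi fun _ => P) := fun i =>
    (measurePreserving_eval (fun _ : Fin (n + 1) => P) i).integrable_comp_of_integrable
      (integrable_pointLoss hφ hP a)
  have hevalI : ∀ i : Fin (n + 1), ∫ Z : Fin (n + 1) → X × Label,
      pointLoss hinge (Z i) (linComb φ a) ∂(Measure.pi fun _ => P) =
        phiRisk hinge P (linComb φ a) := fun i => by
    have h := measurePreserving_eval (fun _ : Fin (n + 1) => P) i
    have h2 := integral_map (f := fun z => pointLoss hinge z (linComb φ a)) h.measurable.aemeasurable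
      (by rw [h.map_eq]; exact (integrable_pointLoss hφ hP a).aestronglyMeasurable)
    rw [h.map_eq] at h2
    exact h2.symm
  have hmain : ∑ m : Fin (n + 1), ∫ Z : Fin (n + 1) → X × Label,
      posteriorLoss φ π β m (Z m) Z ∂(Measure.pi fun _ => P) ≤
      ((n : ℝ) + 1) * (phiRisk hinge P (linComb φ a) + δ + B ^ 2 / (2 * β)) + β * K := by
    rw [← integral_finsetSum _ fun m _ => integrable_posteriorLoss_self hL hβ hφ hπ hP m]
    calc _ ≤ ∫ Z : Fin (n + 1) → X × Label, (∑ i, pointLoss hinge (Z i) (linComb φ a) +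
            (((n : ℝ) + 1) * (δ + B ^ 2 / (2 * β)) + β * K)) ∂(Measure.pi fun _ => P) := by
          refine integral_mono_ae (integrable_finsetSum _ fun m _ =>
            integrable_posteriorLoss_self hL hβ hφ hπ hP m)
            ((integrable_finsetSum _ fun i _ => heval i).add (integrable_const _)) ?_
          filter_upwards [hgood] with Z hZ
          have hreg := exp_weights_regret hβ hρ (B := B)
            (fun (i : Fin (n + 1)) w => pointLoss hinge (Z i) (linComb φ w))
            (fun i => (measurable_pointLoss hφ).comp (measurable_const.prodMk measurable_id))
            (fun i => hπ.mono fun w hw => pointLoss_linComb_mem_Icc hL (hZ i) hw)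
          have hsum : ∑ i, ∫ w, pointLoss hinge (Z i) (linComb φ w) ∂ρ ≤
              ∑ i, pointLoss hinge (Z i) (linComb φ a) + ((n : ℝ) + 1) * δ := by
            refine (Finset.sum_le_sum fun i _ => hδ (Z i) (hZ i)).trans (le_of_eq ?_)
            rw [Finset.sum_add_distrib]; simp
          have hL' : ∀ m : Fin (n + 1), posteriorLoss φ π β m (Z m) Z =
              (∫ w, pointLoss hinge (Z m) (linComb φ w) * expWeight (pointLoss hinge) φ β Z m w ∂π)
                / ∫ w, expWeight (pointLoss hinge) φ β Z m w ∂π := fun m => by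
            simp only [posteriorLoss, posteriorDensity, ← mul_div_assoc]
            rw [integral_div]
          simp only [hL']
          refine hreg.trans ?_
          push_cast
          linarith
      _ = _ := by
          rw [integral_add (integrable_finsetSum _ fun i _ => heval i) (integrable_const _),
            integral_finsetSum _ fun i _ => heval i]
          simp only [hevalI]
          simp
          ring
  have hn : (0 : ℝ) < n + 1 := by positivity
  calc _ ≤ 1 / ((n : ℝ) + 1) *
        (((n : ℝ) + 1) * (phiRisk hinge P (linComb φ a) + δ + B ^ 2 / (2 * β)) + β * K) := by
        gcongr
    _ = _ := by field_simp; ring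

end Density

/-! ### Continuity, closedness and sparsity for the minima -/

section Minimum

variable {M : ℕ} {τ : ℝ}

lemma continuous_log_one_add {g : (Fin M → ℝ) → ℝ} (hg : Continuous g) (h0 : ∀ w, 0 ≤ g w)
    (hτ : 0 < τ) : Continuous fun w => Real.log (1 + τ⁻¹ * g w) := by
  refine Continuous.log (by fun_prop) fun w => ?_
  have := h0 w
  positivity

/-- The set is a finite union of coordinate subspaces. -/
lemma isClosed_l0Norm_le (s : ℕ) : IsClosed {w : Fin M → ℝ | l0Norm w ≤ s} := by
  have h : {w : Fin M → ℝ | l0Norm w ≤ s} =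
      ⋃ S ∈ {S : Finset (Fin M) | S.card ≤ s}, {w | ∀ j, j ∉ S → w j = 0} := by
    ext w
    simp only [Set.mem_iUnion, Set.mem_ofPred_eq, exists_prop]
    refine ⟨fun hw => ⟨_, hw, fun j hj => by simpa using hj⟩, fun ⟨S, hS, hw⟩ => ?_⟩
    refine (Finset.card_le_card fun j hj => ?_).trans hS
    by_contra hjS
    exact (Finset.mem_filter.1 hj).2 (hw j hjS)
  rw [h]
  refine (Set.toFinite _).isClosed_biUnion fun S _ => ?_
  simp only [Set.ofPred_forall]
  exact isClosed_iInter fun j => isClosed_iInter fun _ =>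
    isClosed_eq (continuous_apply j) continuous_const

lemma sum_log_le (hτ : 0 < τ) {s : ℕ} {w : Fin M → ℝ} (hw : l0Norm w ≤ s) :
    ∑ j, Real.log (1 + τ⁻¹ * |w j|) ≤ s * Real.log (1 + τ⁻¹ * l1Norm w) := by
  have hlog : 0 ≤ Real.log (1 + τ⁻¹ * l1Norm w) := Real.log_nonneg (by
    have := l1Norm_nonneg w
    have : 0 ≤ τ⁻¹ * l1Norm w := by positivity
    linarith)
  calc ∑ j, Real.log (1 + τ⁻¹ * |w j|)
      = ∑ j with w j ≠ 0, Real.log (1 + τ⁻¹ * |w j|) := by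
        rw [Finset.sum_filter]
        refine Finset.sum_congr rfl fun j _ => ?_
        split_ifs with h
        · rfl
        · rw [not_not] at h; simp [h]
    _ ≤ ∑ j with w j ≠ 0, Real.log (1 + τ⁻¹ * l1Norm w) := by
        gcongr with j _
        exact abs_le_l1Norm w j
    _ = l0Norm w * Real.log (1 + τ⁻¹ * l1Norm w) := by simp [l0Norm]
    _ ≤ _ := by gcongr

end Minimum

/-! ### The hinge aggregate with the sparsity prior -/

section HingeMA

variable {X : Type*} [MeasurableSpace X] {M n : ℕ} {φ : Fin M → X → ℝ} {R L β τ : ℝ}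
  {P : Measure (X × Label)} [IsProbabilityMeasure P] {η : X → ℝ}

lemma integral_pointLoss_map_add_le {Y : Type*} {φ : Fin M → Y → ℝ}
    (hM : 0 < M) (hL : 0 < L) (hτ : 0 < τ)
    (a : Fin M → ℝ) {z : Y × Label} (hz : ∀ j, |φ j z.1| ≤ L) :
    ∫ w, pointLoss hinge z (linComb φ w) ∂(sparsityPrior M τ (2 * M * τ)).map (a + ·) ≤
      pointLoss hinge z (linComb φ a) + 4 * τ * L * √(M : ℝ) := by
  have hr : 0 < 2 * M * τ := by
    have : (0 : ℝ) < M := by exact_mod_cast hM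
    positivity
  have := isProbabilityMeasure_sparsityPrior (M := M) hτ hr
  have hlin : Continuous fun w : Fin M → ℝ => linComb φ w z.1 := by unfold linComb; fun_prop
  have hc : Continuous fun w : Fin M → ℝ => pointLoss hinge z (linComb φ w) :=
    continuous_hinge.comp (continuous_const.mul hlin)
  rw [integral_map (measurable_const_add a).aemeasurable hc.aestronglyMeasurable]
  calc _ ≤ ∫ w, (pointLoss hinge z (linComb φ a) + |∑ j, w j * φ j z.1|)
          ∂sparsityPrior M τ (2 * M * τ) := by
        refine integral_mono
          (integrable_sparsityPrior hτ hr (hc.comp (continuous_const.add continuous_id)))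
          (integrable_sparsityPrior hτ hr (by fun_prop)) fun w => ?_
        refine (pointLoss_le z _ (linComb φ a)).trans (le_of_eq ?_)
        rw [linComb_add, add_sub_cancel_left, linComb]
    _ ≤ _ := by
        rw [integral_add (integrable_const _) (integrable_sparsityPrior hτ hr (by fun_prop)),
          integral_const, probReal_univ, one_smul]
        exact add_le_add_right (integral_abs_sum_sparsityPrior_le hL hM hτ _ hz) _

lemma expectedExcessRisk_le (hM : 0 < M) (hR : 0 < R) (hL : 0 < L) (hβ : 0 < β) (hτ : 0 < τ)
    (hφ : ∀ j, Measurable (φ j)) (hP : ∀ᵐ z ∂P, ∀ j, |φ j z.1| ≤ L) {a : Fin M → ℝ}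
    (ha : l1Norm a ≤ R - 2 * M * τ) :
    expectedExcessRisk n P η φ τ R β ≤
      (excessHingeRisk P η (linComb φ a)
          + 4 * β / (n + 1) * ∑ j, Real.log (1 + τ⁻¹ * |a j|))
        + 2 * (1 + R * L) ^ 2 / β * Real.exp ((1 + R * L) / β)
        + (4 * τ * L * √(M : ℝ) + β / (n + 1)) := by
  have hr : 0 < 2 * M * τ := by
    have : (0 : ℝ) < M := by exact_mod_cast hM
    positivity
  have hπ := isProbabilityMeasure_sparsityPrior (M := M) hτ hR
  have hπ' := isProbabilityMeasure_sparsityPrior (M := M) hτ hr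
  have hρ : IsProbabilityMeasure ((sparsityPrior M τ (2 * M * τ)).map (a + ·)) :=
    Measure.isProbabilityMeasure_map (measurable_const_add a).aemeasurable
  have h := oracle_inequality (n := n) (P := P) hL.le hβ hφ ae_l1Norm_le_sparsityPrior hP
    (map_add_sparsityPrior_le hM hτ hR ha) a
    fun z hz => integral_pointLoss_map_add_le hM hL hτ a hz
  have hi := integrable_phiRisk_maAggregate (n := n) (P := P) (L := L) hβ hφ
    (ae_l1Norm_le_sparsityPrior (M := M) (τ := τ) (R := R)) hP
  -- The oracle inequality is sharper than required here; the factor `4` and the exponential are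
  -- slack.
  have hrem : (1 + R * L) ^ 2 / (2 * β) ≤
      2 * (1 + R * L) ^ 2 / β * Real.exp ((1 + R * L) / β) := by
    have h1 : 1 ≤ Real.exp ((1 + R * L) / β) := Real.one_le_exp (by positivity)
    calc (1 + R * L) ^ 2 / (2 * β) ≤ 2 * (1 + R * L) ^ 2 / β * 1 := by
          rw [mul_one, div_le_div_iff₀ (by positivity) hβ]
          nlinarith [mul_nonneg (sq_nonneg (1 + R * L)) hβ.le]
      _ ≤ _ := by gcongr
  have hK : β * (1 + 4 * ∑ j, Real.log (1 + τ⁻¹ * |a j|)) / ((n : ℝ) + 1) =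
      β / (n + 1) + 4 * β / (n + 1) * ∑ j, Real.log (1 + τ⁻¹ * |a j|) := by ring
  rw [hK] at h
  simp only [expectedExcessRisk, excessHingeRisk, hingeMA]
  rw [integral_sub hi (integrable_const _), integral_const, probReal_univ, one_smul]
  linarith

lemma continuous_excessHingeRisk_linComb (hφ : ∀ j, Measurable (φ j))
    (hP : ∀ᵐ z ∂P, ∀ j, |φ j z.1| ≤ L) :
    Continuous fun w : Fin M → ℝ => excessHingeRisk P η (linComb φ w) :=
  (continuous_phiRisk_linComb hφ hP).sub continuous_const

lemma exists_isLeast_and_le (hM : 0 < M) (hR : 0 < R) (hL : 0 < L) (hβ : 0 < β) (hτ : 0 < τ)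
    (hτR : 2 * M * τ ≤ R) (hφ : ∀ j, Measurable (φ j)) (hP : ∀ᵐ z ∂P, ∀ j, |φ j z.1| ≤ L) :
    ∃ m : ℝ,
      IsLeast ((fun w : Fin M → ℝ => excessHingeRisk P η (linComb φ w)
          + 4 * β / (n + 1) * ∑ j, Real.log (1 + τ⁻¹ * |w j|)) ''
        {w | l1Norm w ≤ R - 2 * M * τ}) m ∧
      expectedExcessRisk n P η φ τ R β ≤
        m + 2 * (1 + R * L) ^ 2 / β * Real.exp ((1 + R * L) / β)
          + (4 * τ * L * √(M : ℝ) + β / (n + 1)) := by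
  have hc : Continuous fun w : Fin M → ℝ => excessHingeRisk P η (linComb φ w)
      + 4 * β / (n + 1) * ∑ j, Real.log (1 + τ⁻¹ * |w j|) :=
    (continuous_excessHingeRisk_linComb hφ hP).add (continuous_const.mul
      (continuous_finsetSum _ fun j _ =>
        continuous_log_one_add (continuous_apply j).abs (fun _ => abs_nonneg _) hτ))
  obtain ⟨m, hm⟩ := ((isCompact_l1Norm_le (M := M) (R - 2 * M * τ)).image hc).exists_isLeast
    (Set.Nonempty.image _ ⟨0, by simpa [l1Norm] using hτR⟩)
  refine ⟨m, hm, ?_⟩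
  obtain ⟨a, ha, rfl⟩ := hm.1
  exact expectedExcessRisk_le hM hR hL hβ hτ hφ hP ha

/-- With `B = 1 + RL`, `S = √s` and `N = √n`, the temperature is `B N / S`, and each of the four
terms is a multiple of `B S / N`: `4ℓ` from the prior cost, `2e` from the second order term because
`S ≤ N`, `4L` from the spread of `ρ` because `B S ≥ 1`, and `1` from `β / (n + 1)` because `S ≥ 1`.
-/
lemma tuned_remainder_le {R L : ℝ} (hR : 0 < R) (hL : 0 < L) {n s M : ℕ} (hM : 0 < M)
    (hs : 1 ≤ s) (hsn : s ≤ n) {β τ q ℓ : ℝ} (hβ : β = (1 + R * L) * √((n : ℝ) / s))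
    (hτ : τ ≤ 1 / √((n : ℝ) * M)) (hq : q ≤ s * ℓ) (hℓ : 0 ≤ ℓ) :
    4 * β / (n + 1) * q + 2 * (1 + R * L) ^ 2 / β * Real.exp ((1 + R * L) / β)
        + (4 * τ * L * √(M : ℝ) + β / (n + 1)) ≤
      (1 + R * L) * √(s : ℝ) / √(n : ℝ) * (2 * Real.exp 1 + 4 * L + 1 + 4 * ℓ) := by
  set B := 1 + R * L with hB
  have hB1 : 1 ≤ B := by rw [hB]; nlinarith [mul_pos hR hL]
  have hs' : (1 : ℝ) ≤ s := by exact_mod_cast hs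
  have hsn' : (s : ℝ) ≤ n := by exact_mod_cast hsn
  have hM' : (0 : ℝ) < M := by exact_mod_cast hM
  rw [Real.sqrt_div (by positivity)] at hβ
  rw [Real.sqrt_mul (by positivity)] at hτ
  have hS1 : 1 ≤ √(s : ℝ) := Real.one_le_sqrt.2 hs'
  have hSN : √(s : ℝ) ≤ √(n : ℝ) := Real.sqrt_le_sqrt hsn'
  have hS2 : √(s : ℝ) ^ 2 = s := Real.sq_sqrt (by positivity)
  have hN2 : √(n : ℝ) ^ 2 = n := Real.sq_sqrt (by positivity)
  have hm : 0 < √(M : ℝ) := Real.sqrt_pos.2 hM'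
  set S := √(s : ℝ)
  set N := √(n : ℝ)
  have hS : 0 < S := by linarith
  have hN : 0 < N := by linarith
  have hB0 : 0 < B := by linarith
  rw [← hN2, hβ]
  rw [← hS2] at hq
  have h1 : 4 * (B * (N / S)) / (N ^ 2 + 1) * q ≤ B * S / N * (4 * ℓ) := by
    calc 4 * (B * (N / S)) / (N ^ 2 + 1) * q
        ≤ 4 * (B * (N / S)) / (N ^ 2 + 1) * (S ^ 2 * ℓ) := by gcongr
      _ ≤ 4 * (B * (N / S)) / (N ^ 2) * (S ^ 2 * ℓ) := by gcongr; linarith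
      _ = _ := by field_simp
  have h2 : 2 * B ^ 2 / (B * (N / S)) * Real.exp (B / (B * (N / S))) ≤
      B * S / N * (2 * Real.exp 1) := by
    have he : B / (B * (N / S)) = S / N := by field_simp
    rw [he]
    calc 2 * B ^ 2 / (B * (N / S)) * Real.exp (S / N)
        ≤ 2 * B ^ 2 / (B * (N / S)) * Real.exp 1 := by
          gcongr
          exact (div_le_one hN).2 hSN
      _ = _ := by field_simp
  have h3 : 4 * τ * L * √(M : ℝ) ≤ B * S / N * (4 * L) := by
    calc 4 * τ * L * √(M : ℝ) ≤ 4 * (1 / (N * √(M : ℝ))) * L * √(M : ℝ) := by gcongr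
      _ = 1 * 1 / N * (4 * L) := by field_simp
      _ ≤ B * S / N * (4 * L) := by gcongr
  have h4 : B * (N / S) / (N ^ 2 + 1) ≤ B * S / N * 1 := by
    calc B * (N / S) / (N ^ 2 + 1) ≤ B * (N / S) / N ^ 2 := by gcongr; linarith
      _ = B * (1 / S) / N := by field_simp
      _ ≤ B * S / N := by
          gcongr
          exact ((div_le_one hS).2 hS1).trans hS1
      _ = _ := by rw [mul_one]
  linarith

lemma exists_isLeast_sparse_and_le (hM : 0 < M) (hR : 0 < R) (hL : 0 < L)
    (hφ : ∀ j, Measurable (φ j)) (hP : ∀ᵐ z ∂P, ∀ j, |φ j z.1| ≤ L) {s : ℕ} (hs : 1 ≤ s)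
    (hsn : s ≤ n) (hβ : β = (1 + R * L) * √((n : ℝ) / s))
    (hτ : τ = min (1 / √((n : ℝ) * M)) (R / (4 * M))) :
    ∃ m : ℝ,
      IsLeast ((fun w : Fin M → ℝ => excessHingeRisk P η (linComb φ w)
          + (1 + R * L) * √(s : ℝ) / √(n : ℝ)
            * (2 * Real.exp 1 + 4 * L + 1 + 4 * Real.log (1 + τ⁻¹ * l1Norm w))) ''
        {w | l1Norm w ≤ R / 2 ∧ l0Norm w ≤ s}) m ∧
      expectedExcessRisk n P η φ τ R β ≤ m := by
  have hM' : (0 : ℝ) < M := by exact_mod_cast hM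
  have hs' : (0 : ℝ) < s := by exact_mod_cast hs
  have hn' : (0 : ℝ) < n := by exact_mod_cast hs.trans hsn
  have hτ0 : 0 < τ := by
    rw [hτ]
    have : 0 < √((n : ℝ) * M) := Real.sqrt_pos.2 (by positivity)
    exact lt_min (by positivity) (by positivity)
  have hβ0 : 0 < β := by
    rw [hβ]
    have : 0 < √((n : ℝ) / s) := Real.sqrt_pos.2 (by positivity)
    positivity
  -- The second entry of the minimum defining `τ` makes every centre of norm at most `R / 2`
  -- admissible.
  have hτR : 2 * M * τ ≤ R / 2 := by
    have : τ ≤ R / (4 * M) := hτ ▸ min_le_right _ _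
    calc 2 * M * τ ≤ 2 * M * (R / (4 * M)) := by gcongr
      _ = R / 2 := by field_simp; norm_num
  have hc : Continuous fun w : Fin M → ℝ => excessHingeRisk P η (linComb φ w)
      + (1 + R * L) * √(s : ℝ) / √(n : ℝ)
        * (2 * Real.exp 1 + 4 * L + 1 + 4 * Real.log (1 + τ⁻¹ * l1Norm w)) :=
    (continuous_excessHingeRisk_linComb hφ hP).add (continuous_const.mul (continuous_const.add
      (continuous_const.mul (continuous_log_one_add continuous_l1Norm l1Norm_nonneg hτ0))))
  obtain ⟨m, hm⟩ := (((isCompact_l1Norm_le (M := M) (R / 2)).inter_right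
    (isClosed_l0Norm_le s)).image hc).exists_isLeast
    (Set.Nonempty.image _ ⟨0, by simp [l1Norm]; positivity, by simp [l0Norm]⟩)
  refine ⟨m, hm, ?_⟩
  obtain ⟨a, ha, rfl⟩ := hm.1
  have h1 := expectedExcessRisk_le (n := n) (P := P) (η := η) hM hR hL hβ0 hτ0 hφ hP (a := a)
    (by have : l1Norm a ≤ R / 2 := ha.1
        linarith)
  have hlog : 0 ≤ Real.log (1 + τ⁻¹ * l1Norm a) := Real.log_nonneg (by
    have := l1Norm_nonneg a
    have : 0 ≤ τ⁻¹ * l1Norm a := by positivity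
    linarith)
  have h2 := tuned_remainder_le hR hL hM hs hsn hβ (hτ ▸ min_le_left _ _)
    (sum_log_le hτ0 ha.2) hlog
  dsimp only
  linarith

end HingeMA

end MirrorAveraging

theorem proposition5 (R L : ℝ) (hR : 0 < R) (hL : 0 < L) :
    ∃ C : ℝ, 0 < C ∧
    ∀ {X : Type*} [MeasurableSpace X] (P : Measure (X × Label)) [IsProbabilityMeasure P]
      (η : X → ℝ) (_ : IsRegressionFunction P η)
      (M : ℕ) (_ : 2 ≤ M) (φ : Fin M → X → ℝ) (_ : ∀ j, Measurable (φ j))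
      (_ : ∀ j, eLpNorm (φ j) ⊤ (P.map Prod.fst) ≤ ENNReal.ofReal L) (n : ℕ),
      -- the oracle inequality, for all temperatures `β` and prior scales `τ`
      (∀ β τ : ℝ, 0 < β → 0 < τ → 2 * M * τ ≤ R →
        (∀ Z : Fin n → X × Label,
          Integrable (fun z => pointLoss hinge z (hingeMA φ τ R β Z)) P) ∧
        Integrable (fun Z : Fin n → X × Label => excessHingeRisk P η (hingeMA φ τ R β Z))
          (Measure.pi fun _ => P) ∧
        ∃ m : ℝ,
          IsLeast ((fun w : Fin M → ℝ => excessHingeRisk P η (linComb φ w)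
              + 4 * β / (n + 1) * ∑ j, Real.log (1 + τ⁻¹ * |w j|)) ''
            {w | l1Norm w ≤ R - 2 * M * τ}) m ∧
          expectedExcessRisk n P η φ τ R β ≤
            m + 2 * (1 + R * L) ^ 2 / β * Real.exp ((1 + R * L) / β)
              + (4 * τ * L * √(M : ℝ) + β / (n + 1))) ∧
      -- the rate for tuned `β` and `τ`
      (∀ (s : ℕ) (β τ : ℝ), 1 ≤ s → s ≤ n →
        β = (1 + R * L) * √((n : ℝ) / s) →
        τ = min (1 / √((n : ℝ) * M)) (R / (4 * M)) →
        ∃ m : ℝ,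
          IsLeast ((fun w : Fin M → ℝ => excessHingeRisk P η (linComb φ w)
              + (1 + R * L) * √(s : ℝ) / √(n : ℝ)
                * (C + 4 * Real.log (1 + τ⁻¹ * l1Norm w))) ''
            {w | l1Norm w ≤ R / 2 ∧ l0Norm w ≤ s}) m ∧
          expectedExcessRisk n P η φ τ R β ≤ m) := by
  -- The constant collects the three terms of `tuned_remainder_le` that do not involve the
  -- logarithm.
  refine ⟨2 * Real.exp 1 + 4 * L + 1, by positivity, ?_⟩
  intro X _ P _ η _ M hM φ hφ hφL n
  have hM0 : 0 < M := by omega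
  have hP : ∀ᵐ z ∂P, ∀ j, |φ j z.1| ≤ L := ae_abs_le_of_eLpNorm_top_le hL.le hφL
  refine ⟨fun β τ hβ hτ hτR => ⟨fun Z => ?_, ?_,
    exists_isLeast_and_le hM0 hR hL hβ hτ hτR hφ hP⟩, fun s β τ hs hsn hβ hτ =>
    exists_isLeast_sparse_and_le hM0 hR hL hφ hP hs hsn hβ hτ⟩
  · have := isProbabilityMeasure_sparsityPrior (M := M) hτ hR
    rw [hingeMA, maAggregate_eq_linComb hβ hφ ae_l1Norm_le_sparsityPrior]
    exact integrable_pointLoss hφ hP _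
  · have := isProbabilityMeasure_sparsityPrior (M := M) hτ hR
    exact (integrable_phiRisk_maAggregate hβ hφ ae_l1Norm_le_sparsityPrior hP).sub
      (integrable_const _)
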